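/- A quasi-metric on a set $X$ with at least two points is a function $d:X\times X\to[0,\infty)$ such that $d(x,y)=0$ iff $x=y$, and such that for some $C_0,C_1\in(0,\infty)$ one has $d(y,x)\le C_0\,d(x,y)$ and $d(x,y)\le C_1\max\{d(x,z),d(z,y)\}$ for all $x,y,z\in X$. Let $C_d$ be the supremum of $d(x,y)/\max\{d(x,z),d(z,y)\}$ over all $x,y,z\in X$ that are not all equal. Put $B_d(x,r)=\{y: d(x,y)<r\}$, and let $\tau_d$ be the topology whose open sets are the sets containing, with each of their points $x$, some ball $B_d(x,r)$, $r>0$. Two quasi-metrics are equivalent, $\rho\approx d$, if $\kappa^{-1}\rho\le d\le\kappa\rho$ for some $\kappa\in(0,\infty)$. The lower smoothness index is $\mathrm{ind}(X,d)=\sup_{\rho\approx d}(\log_2C_\rho)^{-1}\in(0,\infty]$ (with $1/0=\infty$), the supremum being over all quasi-metrics $\rho$ on $X$ equivalent to $d$. For $\alpha\in(0,\infty)$ and $q\in(0,\infty]$, write $\alpha\preceq\mathrm{ind}(X,d)$ if $\alpha\le\mathrm{ind}(X,d)$, where equality is permitted only if this supremum is attained; and $\alpha\preceq_q\mathrm{ind}(X,d)$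 if $\alpha\le\mathrm{ind}(X,d)$, where equality is permitted only if $q=\infty$ and this supremum is attained. Let $(X,d,\mu)$ be a quasi-metric-measure space: $(X,d)$ is as above, and $\mu$ is a nonnegative measure on a $\sigma$-algebra containing the Borel sets of $\tau_d$ and all balls, with $0<\mu(B_d(x,r))<\infty$ for all $x\in X$, $r\in(0,\infty)$. Let $u:X\to\mathbb R$ be measurable. An $\alpha$-fractional gradient of $u$ is a sequence $\vec g=(g_k)_{k\in\mathbb Z}$ of nonnegative measurable functions for which there is a measurable $\mu$-null set $E$ with $$|u(x)-u(y)|\le d(x,y)^\alpha\,(g_k(x)+g_k(y))\quad\text{whenever } k\in\mathbb Z,\ x,y\in X\setminus E,\ 2^{-k-1}\le d(x,y)<2^{-k};$$ an $\alpha$-gradient of $u$ is a single nonnegative measurable $g$ with $|u(x)-u(y)|\le d(x,y)^\alpha(g(x)+g(y))$ for all $x,y$ outside a measurable $\mu$-null set. Let $\|u\|_{\dot M^\alpha_{p,q}}$ and $\|u\|_{\dot N^\alpha_{p,q}}$ be the infima of $\big\|\,\|(g_k)_k\|_{\ell^q(\mathbb Z)}\big\|_{L^p(X,\mu)}$ and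 of $\big\|(\|g_k\|_{L^p(X,\mu)})_k\big\|_{\ell^q(\mathbb Z)}$, respectively, over all $\alpha$-fractional gradients $\vec g$ of $u$, and let $\|u\|_{\dot M^{\alpha,p}}$ be the infimum of $\|g\|_{L^p(X,\mu)}$ over all $\alpha$-gradients $g$ of $u$. The spaces $M^\alpha_{p,q}$, $N^\alpha_{p,q}$ and $M^{\alpha,p}$ consist of the $u\in L^p(X,\mu)$ for which the respective semi-norm is finite, with (quasi-)norm $\|u\|_{L^p(X,\mu)}$ plus that semi-norm. An embedding of such a space into $L^{\tilde p}(X,\mu)$ is continuous if the space is contained in $L^{\tilde p}(X,\mu)$ with $\|u\|_{L^{\tilde p}}\le C\|u\|$ for a finite constant $C$; it is compact if, moreover, every bounded sequence has a subsequence converging in $L^{\tilde p}(X,\mu)$. **Theorem.** Let $(X,d,\mu)$ be a quasi-metric-measure space. 1. If $\mu(X)<\infty$, then for all $\alpha,p\in(0,\infty)$, $q\in(0,\infty]$ and $\tilde p\in(0,p)$ the embeddings $M^\alpha_{p,q}(X,d,\mu)\hookrightarrow L^{\tilde p}(X,\mu)$, $N^\alpha_{p,q}(X,d,\mu)\hookrightarrow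 L^{\tilde p}(X,\mu)$ and $M^{\alpha,p}(X,d,\mu)\hookrightarrow L^{\tilde p}(X,\mu)$ are compact. 2. If $M^\alpha_{p,q}(X,d,\mu)\hookrightarrow L^{\tilde p}(X,\mu)$ or $N^\alpha_{p,q}(X,d,\mu)\hookrightarrow L^{\tilde p}(X,\mu)$ is continuous for some $p\in(0,\infty)$, $\tilde p\in(0,p)$, $q\in(0,\infty]$ and $\alpha\in(0,\infty)$ with $\alpha\preceq_q\mathrm{ind}(X,d)$, then $\mu(X)<\infty$. 3. If $M^{\alpha,p}(X,d,\mu)\hookrightarrow L^{\tilde p}(X,\mu)$ is continuous for some $p\in(0,\infty)$, $\tilde p\in(0,p)$ and $\alpha\in(0,\infty)$ with $\alpha\preceq\mathrm{ind}(X,d)$, then $\mu(X)<\infty$. -/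

import Mathlib

open MeasureTheory Filter Topology
open scoped ENNReal

noncomputable section

/-- `d` is a quasi-metric on `X`. -/
structure IsQuasiMetric {X : Type*} (d : X → X → ℝ) : Prop where
  nonneg : ∀ x y, 0 ≤ d x y
  eq_zero_iff : ∀ x y, d x y = 0 ↔ x = y
  quasi_symm : ∃ C₀ : ℝ, 0 < C₀ ∧ ∀ x y, d y x ≤ C₀ * d x y
  quasi_triangle : ∃ C₁ : ℝ, 0 < C₁ ∧ ∀ x y z, d x y ≤ C₁ * max (d x z) (d z y)

/-- The ball `B_d(x, r) = {y | d x y < r}`. -/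
def quasiBall {X : Type*} (d : X → X → ℝ) (x : X) (r : ℝ) : Set X :=
  {y | d x y < r}

/-- The topology `τ_d` induced by `d`: a set is open if it contains a `d`-ball around each of its
points (the balls themselves need not be open). -/
@[reducible] def quasiTopology {X : Type*} (d : X → X → ℝ) : TopologicalSpace X where
  IsOpen O := ∀ x ∈ O, ∃ r : ℝ, 0 < r ∧ quasiBall d x r ⊆ O
  isOpen_univ := fun _ _ => ⟨1, one_pos, Set.subset_univ _⟩
  isOpen_inter := by
    rintro s t hs ht x ⟨hxs, hxt⟩
    obtain ⟨r, hr, hrs⟩ := hs x hxs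
    obtain ⟨r', hr', hrt⟩ := ht x hxt
    refine ⟨min r r', lt_min hr hr', fun y hy => ⟨hrs ?_, hrt ?_⟩⟩
    · exact lt_of_lt_of_le (show d x y < min r r' from hy) (min_le_left _ _)
    · exact lt_of_lt_of_le (show d x y < min r r' from hy) (min_le_right _ _)
  isOpen_sUnion := by
    rintro S hS x ⟨t, htS, hxt⟩
    obtain ⟨r, hr, hrt⟩ := hS t htS x hxt
    exact ⟨r, hr, hrt.trans (Set.subset_sUnion_of_mem htS)⟩

/-- The optimal constant `C_d` in the quasi-triangle inequality. For a quasi-metric on a set with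
at least two points the supremum is over a nonempty bounded set and the denominators are
positive. -/
def quasiConst {X : Type*} (d : X → X → ℝ) : ℝ :=
  sSup {t : ℝ | ∃ x y z : X, ¬ (x = y ∧ y = z) ∧ t = d x y / max (d x z) (d z y)}

/-- Equivalence `d ≈ ρ` of quasi-metrics. -/
def QuasiEquiv {X : Type*} (d ρ : X → X → ℝ) : Prop :=
  ∃ κ : ℝ, 0 < κ ∧ ∀ x y, κ⁻¹ * ρ x y ≤ d x y ∧ d x y ≤ κ * ρ x y

/-- `(log₂ C_ρ)⁻¹ ∈ (0, ∞]`, with `1 / 0 = ∞`. -/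
def smoothnessExponent {X : Type*} (ρ : X → X → ℝ) : ℝ≥0∞ :=
  (ENNReal.ofReal (Real.logb 2 (quasiConst ρ)))⁻¹

/-- The lower smoothness index `ind(X, d)`. -/
def lowerSmoothnessIndex {X : Type*} (d : X → X → ℝ) : ℝ≥0∞ :=
  ⨆ (ρ : X → X → ℝ) (_ : IsQuasiMetric ρ ∧ QuasiEquiv d ρ), smoothnessExponent ρ

/-- The supremum that defines `ind(X, d)` is attained. -/
def IndexAttained {X : Type*} (d : X → X → ℝ) : Prop :=
  ∃ ρ : X → X → ℝ, IsQuasiMetric ρ ∧ QuasiEquiv d ρ ∧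
    smoothnessExponent ρ = lowerSmoothnessIndex d

/-- `α ⪯ ind(X, d)`. -/
def PrecIndex {X : Type*} (d : X → X → ℝ) (α : ℝ) : Prop :=
  ENNReal.ofReal α ≤ lowerSmoothnessIndex d ∧
    (ENNReal.ofReal α = lowerSmoothnessIndex d → IndexAttained d)

/-- `α ⪯_q ind(X, d)`. -/
def PrecIndexQ {X : Type*} (d : X → X → ℝ) (q : ℝ≥0∞) (α : ℝ) : Prop :=
  ENNReal.ofReal α ≤ lowerSmoothnessIndex d ∧
    (ENNReal.ofReal α = lowerSmoothnessIndex d → q = ∞ ∧ IndexAttained d)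

/-- `(X, d, μ)` is a quasi-metric-measure space; the sigma-algebra on which `μ` lives is any one
that contains the Borel sets of `τ_d` and the `d`-balls. -/
structure IsQuasiMetricMeasureSpace {X : Type*} [m : MeasurableSpace X] (d : X → X → ℝ)
    (μ : Measure X) : Prop where
  nontrivial : Nontrivial X
  quasiMetric : IsQuasiMetric d
  borel_le : @borel X (quasiTopology d) ≤ m
  measurableSet_ball : ∀ (x : X) (r : ℝ), 0 < r → MeasurableSet (quasiBall d x r)
  ball_pos : ∀ (x : X) (r : ℝ), 0 < r → 0 < μ (quasiBall d x r)
  ball_lt_top : ∀ (x : X) (r : ℝ), 0 < r → μ (quasiBall d x r) < ∞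

/-- `g = (g_k)_{k ∈ ℤ}` is an `α`-fractional gradient of `u`. -/
def IsFracGradient {X : Type*} [MeasurableSpace X] (d : X → X → ℝ) (μ : Measure X) (α : ℝ)
    (u : X → ℝ) (g : ℤ → X → ℝ≥0∞) : Prop :=
  (∀ k, Measurable (g k)) ∧
    ∃ E : Set X, MeasurableSet E ∧ μ E = 0 ∧
      ∀ (k : ℤ) (x y : X), x ∉ E → y ∉ E →
        (2 : ℝ) ^ (-k - 1) ≤ d x y → d x y < (2 : ℝ) ^ (-k) →
          ENNReal.ofReal |u x - u y| ≤ ENNReal.ofReal (d x y ^ α) * (g k x + g k y)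

/-- `g` is an `α`-gradient of `u`. -/
def IsGradient {X : Type*} [MeasurableSpace X] (d : X → X → ℝ) (μ : Measure X) (α : ℝ)
    (u : X → ℝ) (g : X → ℝ≥0∞) : Prop :=
  Measurable g ∧
    ∃ E : Set X, MeasurableSet E ∧ μ E = 0 ∧
      ∀ x y : X, x ∉ E → y ∉ E →
        ENNReal.ofReal |u x - u y| ≤ ENNReal.ofReal (d x y ^ α) * (g x + g y)

/-- The `ℓ^q(ℤ)` (quasi-)norm of a nonnegative sequence, `q ∈ (0, ∞]`. -/
def seqNorm (q : ℝ≥0∞) (a : ℤ → ℝ≥0∞) : ℝ≥0∞ :=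
  if q = ∞ then ⨆ k, a k else (∑' k, a k ^ q.toReal) ^ (1 / q.toReal)

/-- The homogeneous Hajłasz–Triebel–Lizorkin semi-norm. -/
def tlSeminorm {X : Type*} [MeasurableSpace X] (d : X → X → ℝ) (μ : Measure X) (α : ℝ)
    (p q : ℝ≥0∞) (u : X → ℝ) : ℝ≥0∞ :=
  ⨅ (g : ℤ → X → ℝ≥0∞) (_ : IsFracGradient d μ α u g),
    eLpNorm (fun x => seqNorm q (fun k => g k x)) p μ

/-- The homogeneous Hajłasz–Besov semi-norm. -/
def besovSeminorm {X : Type*} [MeasurableSpace X] (d : X → X → ℝ) (μ : Measure X) (α : ℝ)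
    (p q : ℝ≥0∞) (u : X → ℝ) : ℝ≥0∞ :=
  ⨅ (g : ℤ → X → ℝ≥0∞) (_ : IsFracGradient d μ α u g),
    seqNorm q (fun k => eLpNorm (g k) p μ)

/-- The homogeneous fractional Hajłasz–Sobolev semi-norm. -/
def sobolevSeminorm {X : Type*} [MeasurableSpace X] (d : X → X → ℝ) (μ : Measure X) (α : ℝ)
    (p : ℝ≥0∞) (u : X → ℝ) : ℝ≥0∞ :=
  ⨅ (g : X → ℝ≥0∞) (_ : IsGradient d μ α u g), eLpNorm g p μ

/-- Given a homogeneous semi-norm `s`, the members of the inhomogeneous space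
`{u ∈ L^p(X, μ) : s u < ∞}`, as measurable real functions. -/
def inhomSpace {X : Type*} [MeasurableSpace X] (μ : Measure X) (p : ℝ≥0∞)
    (s : (X → ℝ) → ℝ≥0∞) : Set (X → ℝ) :=
  {u | Measurable u ∧ MemLp u p μ ∧ s u < ∞}

/-- The (quasi-)norm `‖u‖_{L^p} + s u` of the inhomogeneous space. -/
def inhomNorm {X : Type*} [MeasurableSpace X] (μ : Measure X) (p : ℝ≥0∞)
    (s : (X → ℝ) → ℝ≥0∞) (u : X → ℝ) : ℝ≥0∞ :=
  eLpNorm u p μ + s u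

/-- The inhomogeneous space with exponent `p` and semi-norm `s` embeds continuously into
`L^r(X, μ)`. -/
def EmbedsContinuously {X : Type*} [MeasurableSpace X] (μ : Measure X) (p : ℝ≥0∞)
    (s : (X → ℝ) → ℝ≥0∞) (r : ℝ≥0∞) : Prop :=
  (∀ u ∈ inhomSpace μ p s, MemLp u r μ) ∧
    ∃ C : ℝ≥0∞, C < ∞ ∧ ∀ u ∈ inhomSpace μ p s, eLpNorm u r μ ≤ C * inhomNorm μ p s u

/-- The inhomogeneous space with exponent `p` and semi-norm `s` embeds compactly into
`L^r(X, μ)`: the embedding is continuous, and every sequence that is bounded in the space has a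
subsequence that converges in `L^r(X, μ)`. -/
def EmbedsCompactly {X : Type*} [MeasurableSpace X] (μ : Measure X) (p : ℝ≥0∞)
    (s : (X → ℝ) → ℝ≥0∞) (r : ℝ≥0∞) : Prop :=
  EmbedsContinuously μ p s r ∧
    ∀ u : ℕ → X → ℝ, (∀ n, u n ∈ inhomSpace μ p s) →
      (∃ R : ℝ≥0∞, R < ∞ ∧ ∀ n, inhomNorm μ p s (u n) ≤ R) →
        ∃ (φ : ℕ → ℕ) (v : X → ℝ), StrictMono φ ∧ MemLp v r μ ∧
          Tendsto (fun n => eLpNorm (u (φ n) - v) r μ) atTop (𝓝 0)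

end

/-! Finiteness of the measure: for an admissible `α`, some equivalent quasi-metric `ρ` has
`quasiConst ρ ^ (α + γ) ≤ 2` with `γ ≥ 0`. Frink's chain argument then yields a function `F`, Hölder
of order `α + γ` for `d`, whose sublevel sets lie in balls (`exists_radial_function`). Cutting `F`
off between the levels `r` and `r + η` gives bumps whose gradients are supported in `{F < r + η}`
and have size `const / η`. Testing the embedding on them gives `V r ^ (p / p') ≤ (D / η) ^ p * V (r
+ η)` for the volumes `V r = μ {F < r}` and `0 < η ≤ 1`. Since `p / p' > 1`, iterating with `η =
1/2, 1/4, …` from a level `R` with `V R` large would force `V (R + 1) = ∞`, although `V` is finite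
everywhere. So `V` is bounded (`false_of_superlinear_growth`).

Compactness: in each space a bounded sequence has gradients of some fixed order `β > 0` bounded in
`L^p`; the smoothness index plays no role. Off a set of small measure `u` and its gradient are
bounded, so `u` is nearly constant on the small pieces of a countable cover that serves all members
of the sequence. As `μ` is finite, finitely many pieces carry almost all the mass, which gives a
subsequence that is Cauchy in measure and then one that converges almost everywhere
(`exists_subseq_ae_tendsto_of_gradient_bound`). The `L^p` bound makes the `p'`-th powers uniformly
integrable because `p' < p`, and convergence in `L^p'` follows
(`tendsto_eLpNorm_zero_of_ae_of_bounded`). -/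

/-! ### Chain sums and the chain distance -/

/-- Frink's chain inequality. -/
theorem frink_chain_aux {X : Type*} {δ : X → X → ℝ} (h0 : ∀ x y, 0 ≤ δ x y)
    (h2 : ∀ x y z, δ x y ≤ 2 * max (δ x z) (δ z y)) (c : ℕ → X) :
    ∀ n a b, b - a = n → a < b →
      δ (c a) (c (b + 1)) + 2 * δ (c a) (c (a + 1)) + 2 * δ (c b) (c (b + 1)) ≤
        4 * ∑ i ∈ Finset.Ico a (b + 1), δ (c i) (c (i + 1)) := by
  intro n
  induction n using Nat.strong_induction_on with
  | _ n ih =>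
  intro a b hn hab
  classical
  -- The chain is split at the last vertex `r` at least half as far from the end as `c a` is; by the
  -- max inequality `r + 1` is then at least half as far from the start.
  let P : ℕ → Prop := fun r => a ≤ r ∧ δ (c a) (c (b + 1)) ≤ 2 * δ (c r) (c (b + 1))
  have hPa : P a := ⟨le_rfl, by linarith [h0 (c a) (c (b + 1))]⟩
  have hspec : P (Nat.findGreatest P b) := Nat.findGreatest_spec hab.le hPa
  have hrb : Nat.findGreatest P b ≤ b := Nat.findGreatest_le b
  have hgr : ∀ k, Nat.findGreatest P b < k → k ≤ b → ¬ P k :=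
    fun k h1 h2 => Nat.findGreatest_is_greatest h1 h2
  generalize Nat.findGreatest P b = r at hspec hrb hgr
  obtain ⟨har, hr⟩ := hspec
  have hends : δ (c a) (c (a + 1)) + δ (c b) (c (b + 1)) ≤
      ∑ i ∈ Finset.Ico a (b + 1), δ (c i) (c (i + 1)) := by
    rw [Finset.sum_Ico_succ_top hab.le, Finset.sum_eq_sum_Ico_succ_bot hab]
    have : 0 ≤ ∑ i ∈ Finset.Ico (a + 1) b, δ (c i) (c (i + 1)) :=
      Finset.sum_nonneg fun i _ => h0 _ _
    linarith
  have ha0 := h0 (c a) (c (a + 1))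
  have hb0 := h0 (c b) (c (b + 1))
  rcases hrb.eq_or_lt with rfl | hrb
  · linarith
  have hnot : δ (c a) (c (b + 1)) ≤ 2 * δ (c a) (c (r + 1)) := by
    have h3 := hgr (r + 1) (by omega) hrb
    have h4 : ¬ δ (c a) (c (b + 1)) ≤ 2 * δ (c (r + 1)) (c (b + 1)) :=
      fun h => h3 ⟨by omega, h⟩
    rcases max_choice (δ (c a) (c (r + 1))) (δ (c (r + 1)) (c (b + 1))) with h | h
    · simpa [h] using h2 (c a) (c (b + 1)) (c (r + 1))
    · exact absurd (by simpa [h] using h2 (c a) (c (b + 1)) (c (r + 1))) h4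
  rcases har.eq_or_lt with rfl | har
  · linarith
  -- The two blocks overlap in the link `r`; the doubled end terms in the statement pay for counting
  -- it twice.
  have i1 := ih (r - a) (by omega) a r rfl har
  have i2 := ih (b - r) (by omega) r b rfl hrb
  have hs : ∑ i ∈ Finset.Ico a (r + 1), δ (c i) (c (i + 1)) +
      ∑ i ∈ Finset.Ico r (b + 1), δ (c i) (c (i + 1)) =
      ∑ i ∈ Finset.Ico a (b + 1), δ (c i) (c (i + 1)) + δ (c r) (c (r + 1)) := by
    rw [Finset.sum_Ico_succ_top har.le,
      ← Finset.sum_Ico_consecutive _ har.le (by omega : r ≤ b + 1)]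
    ring
  linarith

theorem le_four_mul_chain_sum {X : Type*} {δ : X → X → ℝ} (h0 : ∀ x y, 0 ≤ δ x y)
    (hself : ∀ x, δ x x = 0)
    (h2 : ∀ x y z, δ x y ≤ 2 * max (δ x z) (δ z y)) (c : ℕ → X) (n : ℕ) :
    δ (c 0) (c n) ≤ 4 * ∑ i ∈ Finset.range n, δ (c i) (c (i + 1)) := by
  rcases n with _ | _ | n
  · simp [hself]
  · simpa using by linarith [h0 (c 0) (c 1)]
  · have := frink_chain_aux h0 h2 c (n + 1) 0 (n + 1) (by omega) (by omega)
    rw [Finset.range_eq_Ico]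
    linarith [h0 (c 0) (c (0 + 1)), h0 (c (n + 1)) (c (n + 1 + 1))]

/-- The chain distance to a point is comparable with the quasi-metric. -/
theorem exists_chain_distance {X : Type*} {δ : X → X → ℝ} (h0 : ∀ x y, 0 ≤ δ x y)
    (hself : ∀ x, δ x x = 0) (h2 : ∀ x y z, δ x y ≤ 2 * max (δ x z) (δ z y)) (x₀ : X) :
    ∃ F : X → ℝ, (∀ x, δ x₀ x ≤ 4 * F x) ∧ ∀ x y, F y ≤ F x + δ x y := by
  -- `F` is the infimum of chain sums from `x₀`. As `δ` need not be symmetric, the increment bound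
  -- is one-sided: a chain to `x` is prolonged by `y`.
  let S : X → Set ℝ := fun x => {s | ∃ (n : ℕ) (c : ℕ → X), c 0 = x₀ ∧ c n = x ∧
    s = ∑ i ∈ Finset.range n, δ (c i) (c (i + 1))}
  have hS : ∀ x, (S x).Nonempty := fun x =>
    ⟨_, 1, fun i => if i = 0 then x₀ else x, by simp, by simp, rfl⟩
  have hB : ∀ x, BddBelow (S x) := fun x => ⟨0, by
    rintro _ ⟨n, c, -, -, rfl⟩
    exact Finset.sum_nonneg fun i _ => h0 _ _⟩
  refine ⟨fun x => sInf (S x), fun x => ?_, fun x y => ?_⟩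
  · suffices δ x₀ x / 4 ≤ sInf (S x) by linarith
    refine le_csInf (hS x) ?_
    rintro _ ⟨n, c, rfl, rfl, rfl⟩
    linarith [le_four_mul_chain_sum h0 hself h2 c n]
  · suffices sInf (S y) - δ x y ≤ sInf (S x) by linarith
    refine le_csInf (hS x) ?_
    rintro _ ⟨n, c, h0c, rfl, rfl⟩
    rw [sub_le_iff_le_add]
    refine csInf_le (hB y) ⟨n + 1, fun i => if i ≤ n then c i else y, by simpa using h0c,
      by simp, ?_⟩
    rw [Finset.sum_range_succ]
    congr 1
    · refine Finset.sum_congr rfl fun i hi => ?_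
      have := Finset.mem_range.1 hi
      simp [this.le, Nat.succ_le_of_lt this]
    · simp

/-! ### The optimal constant and the smoothness index -/

theorem IsQuasiMetric.self {X : Type*} {d : X → X → ℝ} (hd : IsQuasiMetric d) (x : X) :
    d x x = 0 := (hd.eq_zero_iff x x).2 rfl

theorem IsQuasiMetric.max_pos {X : Type*} {d : X → X → ℝ} (hd : IsQuasiMetric d) {x y z : X}
    (h : ¬ (x = y ∧ y = z)) : 0 < max (d x z) (d z y) := by
  by_contra hc
  have h1 : d x z ≤ 0 := (le_max_left _ _).trans (not_lt.1 hc)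
  have h2 : d z y ≤ 0 := (le_max_right _ _).trans (not_lt.1 hc)
  have e1 := (hd.eq_zero_iff x z).1 (le_antisymm h1 (hd.nonneg _ _))
  have e2 := (hd.eq_zero_iff z y).1 (le_antisymm h2 (hd.nonneg _ _))
  exact h ⟨e1.trans e2, e2.symm⟩

theorem IsQuasiMetric.le_quasiConst {X : Type*} {d : X → X → ℝ} (hd : IsQuasiMetric d)
    {x y z : X} (h : ¬ (x = y ∧ y = z)) : d x y / max (d x z) (d z y) ≤ quasiConst d := by
  obtain ⟨C, -, hC⟩ := hd.quasi_triangle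
  refine le_csSup ⟨C, ?_⟩ ⟨x, y, z, h, rfl⟩
  rintro _ ⟨x, y, z, h, rfl⟩
  rw [div_le_iff₀ (hd.max_pos h)]
  exact hC x y z

theorem IsQuasiMetric.le_quasiConst_mul_max {X : Type*} {d : X → X → ℝ} (hd : IsQuasiMetric d)
    (x y z : X) : d x y ≤ quasiConst d * max (d x z) (d z y) := by
  by_cases h : x = y ∧ y = z
  · obtain ⟨rfl, rfl⟩ := h
    simp [hd.self]
  · exact (div_le_iff₀ (hd.max_pos h)).1 (hd.le_quasiConst h)

theorem IsQuasiMetric.one_le_quasiConst {X : Type*} [Nontrivial X] {d : X → X → ℝ}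
    (hd : IsQuasiMetric d) : 1 ≤ quasiConst d := by
  obtain ⟨x, y, hxy⟩ := exists_pair_ne X
  have hp : d x y ≠ 0 := fun h => hxy ((hd.eq_zero_iff _ _).1 h)
  have := hd.le_quasiConst (x := x) (y := y) (z := y) (by simp [hxy])
  rwa [hd.self, max_eq_left (hd.nonneg _ _), div_self hp] at this

/-- This form of the index condition says that `d ^ α` satisfies the max inequality with constant 2,
as the chain argument requires. -/
theorem IsQuasiMetric.quasiConst_rpow_le_two {X : Type*} [Nontrivial X] {d : X → X → ℝ}
    (hd : IsQuasiMetric d) {α : ℝ} (hα : 0 < α)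
    (h : ENNReal.ofReal α ≤ smoothnessExponent d) : quasiConst d ^ α ≤ 2 := by
  have h1 := hd.one_le_quasiConst
  have hpos : 0 < quasiConst d := by linarith
  rw [smoothnessExponent, ENNReal.le_inv_iff_mul_le, ← ENNReal.ofReal_mul hα.le,
    ENNReal.ofReal_le_one] at h
  calc quasiConst d ^ α = ((2 : ℝ) ^ Real.logb 2 (quasiConst d)) ^ α := by
        rw [Real.rpow_logb two_pos (by norm_num) hpos]
    _ = (2 : ℝ) ^ (α * Real.logb 2 (quasiConst d)) := by
        rw [← Real.rpow_mul two_pos.le, mul_comm]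
    _ ≤ (2 : ℝ) ^ (1 : ℝ) := Real.rpow_le_rpow_of_exponent_le (by norm_num) h
    _ = 2 := by norm_num

/-- Strictness leaves room for a real `β` between `α` and the exponent of some `ρ`, which may be
infinite; the surplus is `γ = β - α`. -/
theorem exists_quasiConst_rpow_le_two_of_lt {X : Type*} [Nontrivial X] {d : X → X → ℝ} {α : ℝ}
    (hα : 0 < α) (h : ENNReal.ofReal α < lowerSmoothnessIndex d) :
    ∃ γ > 0, ∃ ρ : X → X → ℝ, IsQuasiMetric ρ ∧ QuasiEquiv d ρ ∧ quasiConst ρ ^ (α + γ) ≤ 2 := by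
  obtain ⟨ρ, hρ⟩ := lt_iSup_iff.1 h
  obtain ⟨⟨hρ1, hρ2⟩, hlt⟩ := lt_iSup_iff.1 hρ
  obtain ⟨β, -, h1, h2⟩ := ENNReal.lt_iff_exists_real_btwn.1 hlt
  have hβ : α < β := (ENNReal.ofReal_lt_ofReal_iff_of_nonneg hα.le).1 h1
  refine ⟨β - α, by linarith, ρ, hρ1, hρ2, ?_⟩
  rw [add_sub_cancel]
  exact hρ1.quasiConst_rpow_le_two (hα.trans hβ) h2.le

theorem PrecIndex.exists_quasiConst_rpow_le_two {X : Type*} [Nontrivial X] {d : X → X → ℝ}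
    {α : ℝ} (hα : 0 < α) (h : PrecIndex d α) :
    ∃ ρ : X → X → ℝ, IsQuasiMetric ρ ∧ QuasiEquiv d ρ ∧ quasiConst ρ ^ α ≤ 2 := by
  rcases h.1.eq_or_lt with he | hlt
  · obtain ⟨ρ, h1, h2, h3⟩ := h.2 he
    exact ⟨ρ, h1, h2, h1.quasiConst_rpow_le_two hα (he.trans h3.symm).le⟩
  · obtain ⟨γ, hγ, ρ, h1, h2, h3⟩ := exists_quasiConst_rpow_le_two_of_lt hα hlt
    exact ⟨ρ, h1, h2, (Real.rpow_le_rpow_of_exponent_le h1.one_le_quasiConst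
      (by linarith)).trans h3⟩

/-- A surplus `γ > 0` will make the scales of a fractional gradient summable in `ℓ^q`. At equality
with the index no surplus is at hand, but there `q = ∞` and boundedness suffices. -/
theorem PrecIndexQ.exists_quasiConst_rpow_le_two {X : Type*} [Nontrivial X] {d : X → X → ℝ}
    {α : ℝ} {q : ℝ≥0∞} (hα : 0 < α) (h : PrecIndexQ d q α) :
    ∃ γ : ℝ, 0 ≤ γ ∧ (q = ∞ ∨ 0 < γ) ∧
      ∃ ρ : X → X → ℝ, IsQuasiMetric ρ ∧ QuasiEquiv d ρ ∧ quasiConst ρ ^ (α + γ) ≤ 2 := by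
  rcases h.1.eq_or_lt with he | hlt
  · obtain ⟨ρ, h1, h2, h3⟩ :=
      PrecIndex.exists_quasiConst_rpow_le_two hα ⟨h.1, fun he => (h.2 he).2⟩
    exact ⟨0, le_rfl, Or.inl (h.2 he).1, ρ, h1, h2, by simpa using h3⟩
  · obtain ⟨γ, hγ, h'⟩ := exists_quasiConst_rpow_le_two_of_lt hα hlt
    exact ⟨γ, hγ.le, Or.inr hγ, h'⟩

/-! ### The radial function -/

/-- A Hölder continuous function of order `β` that is comparable with `d x₀ · ^ β`. -/
theorem exists_radial_function {X : Type*} {d ρ : X → X → ℝ} (hd : IsQuasiMetric d)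
    (hρ : IsQuasiMetric ρ) (he : QuasiEquiv d ρ) {β : ℝ} (hβ : 0 < β)
    (hc : quasiConst ρ ^ β ≤ 2) (x₀ : X) :
    ∃ (F : X → ℝ) (κ : ℝ), 0 < κ ∧ (∀ x y, |F x - F y| ≤ κ * d x y ^ β) ∧
      ∀ x, d x₀ x ^ β ≤ κ * F x := by
  obtain ⟨κ, hκ, hκd⟩ := he
  obtain ⟨C, hC, hCd⟩ := hd.quasi_symm
  have hρd : ∀ x y, ρ x y ≤ κ * d x y := fun x y => by
    have := (hκd x y).1
    rwa [inv_mul_le_iff₀ hκ] at this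
  have hQ : 0 ≤ quasiConst ρ := by
    refine Real.sSup_nonneg ?_
    rintro _ ⟨x, y, z, -, rfl⟩
    exact div_nonneg (hρ.nonneg _ _) (le_max_of_le_left (hρ.nonneg _ _))
  obtain ⟨F, hF1, hF2⟩ := exists_chain_distance (δ := fun x y => ρ x y ^ β)
    (fun x y => Real.rpow_nonneg (hρ.nonneg x y) _)
    (fun x => by simp [hρ.self, Real.zero_rpow hβ.ne'])
    (fun x y z => by
      have hm : (max (ρ x z) (ρ z y)) ^ β = max (ρ x z ^ β) (ρ z y ^ β) :=
        (Real.monotoneOn_rpow_Ici_of_exponent_nonneg hβ.le).map_max (hρ.nonneg _ _)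
          (hρ.nonneg _ _)
      calc ρ x y ^ β ≤ (quasiConst ρ * max (ρ x z) (ρ z y)) ^ β :=
            Real.rpow_le_rpow (hρ.nonneg _ _) (hρ.le_quasiConst_mul_max x y z) hβ.le
        _ = quasiConst ρ ^ β * max (ρ x z ^ β) (ρ z y ^ β) := by
            rw [Real.mul_rpow hQ (le_max_of_le_left (hρ.nonneg _ _)), hm]
        _ ≤ 2 * max (ρ x z ^ β) (ρ z y ^ β) := by
            have := Real.rpow_nonneg (hρ.nonneg x z) β
            gcongr) x₀
  have hκβ : 0 < κ ^ β := Real.rpow_pos_of_pos hκ _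
  have hCβ : 0 < C ^ β := Real.rpow_pos_of_pos hC _
  have hF0 : ∀ x, 0 ≤ F x := fun x => by
    have := hF1 x
    linarith [Real.rpow_nonneg (hρ.nonneg x₀ x) β]
  have hb : ∀ x y, ρ x y ^ β ≤ κ ^ β * d x y ^ β := fun x y => by
    rw [← Real.mul_rpow hκ.le (hd.nonneg _ _)]
    exact Real.rpow_le_rpow (hρ.nonneg _ _) (hρd _ _) hβ.le
  have hs : ∀ x y, d y x ^ β ≤ C ^ β * d x y ^ β := fun x y => by
    rw [← Real.mul_rpow hC.le (hd.nonneg _ _)]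
    exact Real.rpow_le_rpow (hd.nonneg _ _) (hCd _ _) hβ.le
  -- The 4 comes from the chain comparison, `C ^ β` from the increment with the points exchanged,
  -- and `κ ^ β` from passing between `ρ` and `d`.
  refine ⟨F, κ ^ β * (4 + C ^ β), by positivity, fun x y => ?_, fun x => ?_⟩
  · have h1 := hF2 x y
    have h2 := hF2 y x
    have hn := Real.rpow_nonneg (hd.nonneg x y) β
    have h3 : κ ^ β * d y x ^ β ≤ κ ^ β * (C ^ β * d x y ^ β) :=
      mul_le_mul_of_nonneg_left (hs x y) hκβ.le
    have h4 := hb x y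
    have h5 := hb y x
    have h6 : 0 ≤ κ ^ β * d x y ^ β := by positivity
    have h7 : 0 ≤ κ ^ β * (C ^ β * d x y ^ β) := by positivity
    rw [abs_le]
    constructor <;> nlinarith
  · have h1 : d x₀ x ^ β ≤ κ ^ β * ρ x₀ x ^ β := by
      rw [← Real.mul_rpow hκ.le (hρ.nonneg _ _)]
      exact Real.rpow_le_rpow (hd.nonneg _ _) (hκd _ _).2 hβ.le
    have h2 : κ ^ β * ρ x₀ x ^ β ≤ κ ^ β * (4 * F x) :=
      mul_le_mul_of_nonneg_left (hF1 x) hκβ.le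
    have h3 : 0 ≤ κ ^ β * C ^ β * F x := by have := hF0 x; positivity
    nlinarith

/-- The Hölder bound keeps a whole ball around each point of `{F < t}` below the level `t`, so this
set is open for `τ_d` even though balls need not be. -/
theorem measurable_of_holder {X : Type*} [m : MeasurableSpace X] {d : X → X → ℝ} {μ : Measure X}
    (hX : IsQuasiMetricMeasureSpace d μ) {F : X → ℝ} {κ β : ℝ} (hβ : 0 < β) (hκ : 0 < κ)
    (hF : ∀ x y, |F x - F y| ≤ κ * d x y ^ β) : Measurable F := by
  refine measurable_of_Iio fun t => hX.borel_le _ (MeasurableSpace.measurableSet_generateFrom ?_)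
  intro x hx
  have hx' : 0 < t - F x := sub_pos.2 hx
  refine ⟨((t - F x) / κ) ^ β⁻¹, by positivity, fun y hy => ?_⟩
  have hy' : d x y < ((t - F x) / κ) ^ β⁻¹ := hy
  have h1 : d x y ^ β < (t - F x) / κ := by
    have := Real.rpow_lt_rpow (hX.quasiMetric.nonneg x y) hy' hβ
    rwa [Real.rpow_inv_rpow (by positivity) hβ.ne'] at this
  rw [lt_div_iff₀' hκ] at h1
  have h2 := (abs_le.1 (hF x y)).1
  show F y < t
  linarith

/-! ### Superlinear growth -/

/-- A nondecreasing function cannot be finite and grow superlinearly over every short interval. -/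
theorem false_of_superlinear_growth {V : ℝ → ℝ} (hmono : Monotone V)
    {s p C : ℝ} (hs : 1 < s) (hp : 0 < p) (hC : 0 < C)
    (h : ∀ r η, 0 < η → η ≤ 1 → V r ^ s ≤ (C / η) ^ p * V (r + η))
    (hunb : ∀ M, ∃ R, M ≤ V R) : False := by
  have hs' : 0 < s - 1 := by linarith
  -- `l ^ (s - 1) = 2 ^ p` absorbs the loss from halving `η` at each step, and `M` is chosen so that
  -- `(M * l ^ j) ^ s` equals `(C / η) ^ p * (M * l ^ (j + 1))` for `η = (1 / 2) ^ (j + 1)`.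
  set l : ℝ := (2 : ℝ) ^ (p / (s - 1)) with hl
  have hl1 : 1 < l := Real.one_lt_rpow (by norm_num) (by positivity)
  have hl0 : 0 < l := by linarith
  have hls : l ^ (s - 1) = 2 ^ p := by
    rw [hl, ← Real.rpow_mul (by norm_num), div_mul_cancel₀ _ hs'.ne']
  set M : ℝ := ((C * 2) ^ p * l) ^ (s - 1)⁻¹ with hM
  have hM0 : 0 < M := by positivity
  have hMs : M ^ (s - 1) = (C * 2) ^ p * l := by
    rw [hM, Real.rpow_inv_rpow (by positivity) hs'.ne']
  obtain ⟨R, hR⟩ := hunb M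
  -- The step lengths sum to 1, so all the points stay below `R + 1`.
  have key : ∀ j : ℕ, M * l ^ j ≤ V (R + 1 - (1 / 2) ^ j) := by
    intro j
    induction j with
    | zero => simpa using hR
    | succ j ih =>
      have hη : (0 : ℝ) < (1 / 2) ^ (j + 1) := by positivity
      have h1 := h (R + 1 - (1 / 2) ^ j) ((1 / 2) ^ (j + 1)) hη
        (pow_le_one₀ (by norm_num) (by norm_num))
      have he : R + 1 - (1 / 2 : ℝ) ^ j + (1 / 2) ^ (j + 1) = R + 1 - (1 / 2) ^ (j + 1) := by
        rw [pow_succ]; ring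
      rw [he] at h1
      have h2 : (M * l ^ j) ^ s ≤ V (R + 1 - (1 / 2) ^ j) ^ s :=
        Real.rpow_le_rpow (by positivity) ih (by linarith)
      have h3 : (M * l ^ j) ^ s = (C / (1 / 2) ^ (j + 1)) ^ p * (M * l ^ (j + 1)) := by
        have e1 : (M * l ^ j) ^ s = (M * l ^ j) ^ (s - 1) * (M * l ^ j) := by
          conv_rhs => rw [← Real.rpow_add_one (by positivity)]
          simp
        have e2 : (l ^ j) ^ (s - 1) = (2 ^ j) ^ p := by
          rw [← Real.rpow_natCast l, ← Real.rpow_mul hl0.le, mul_comm, Real.rpow_mul hl0.le, hls,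
            ← Real.rpow_natCast 2, ← Real.rpow_mul (by norm_num), ← Real.rpow_mul (by norm_num),
            mul_comm]
        have e3 : C / (1 / 2) ^ (j + 1) = (C * 2) * 2 ^ j := by
          rw [one_div, inv_pow, div_inv_eq_mul, pow_succ]; ring
        rw [e1, Real.mul_rpow hM0.le (by positivity), hMs, e2, e3,
          Real.mul_rpow (x := C * 2) (y := 2 ^ j) (by positivity) (by positivity), pow_succ]
        ring
      rw [h3] at h2
      exact le_of_mul_le_mul_left (h2.trans h1) (by positivity)
  obtain ⟨j, hj⟩ := pow_unbounded_of_one_lt (V (R + 1) / M) hl1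
  rw [div_lt_iff₀' hM0] at hj
  have : V (R + 1 - (1 / 2) ^ j) ≤ V (R + 1) := hmono (by
    have : (0 : ℝ) < (1 / 2) ^ j := by positivity
    linarith)
  linarith [key j]

/-! ### Cut-off functions of the radial function -/

/-- The function equal to `1` where `F ≤ r`, to `0` where `r + η ≤ F`, and affine in `F` between. -/
noncomputable def radialBump {X : Type*} (F : X → ℝ) (r η : ℝ) (x : X) : ℝ :=
  max 0 (min 1 ((r + η - F x) / η))

theorem radialBump_nonneg {X : Type*} (F : X → ℝ) (r η : ℝ) (x : X) : 0 ≤ radialBump F r η x :=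
  le_max_left _ _

theorem radialBump_le_one {X : Type*} (F : X → ℝ) (r η : ℝ) (x : X) : radialBump F r η x ≤ 1 :=
  max_le zero_le_one (min_le_left _ _)

theorem radialBump_eq_one {X : Type*} {F : X → ℝ} {r η : ℝ} (hη : 0 < η) {x : X} (h : F x < r) :
    radialBump F r η x = 1 := by
  have : 1 ≤ (r + η - F x) / η := by rw [le_div_iff₀ hη]; linarith
  simp [radialBump, this]

theorem radialBump_eq_zero {X : Type*} {F : X → ℝ} {r η : ℝ} (hη : 0 < η) {x : X}
    (h : ¬ F x < r + η) : radialBump F r η x = 0 := by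
  have : (r + η - F x) / η ≤ 0 := div_nonpos_of_nonpos_of_nonneg (by linarith) hη.le
  simp [radialBump, min_le_of_right_le this]

theorem abs_radialBump_sub_le {X : Type*} (F : X → ℝ) (r : ℝ) {η : ℝ} (hη : 0 < η) (x y : X) :
    |radialBump F r η x - radialBump F r η y| ≤ |F x - F y| / η := by
  have h1 := abs_max_sub_max_le_max (0 : ℝ) (min 1 ((r + η - F x) / η)) 0
    (min 1 ((r + η - F y) / η))
  have h2 := abs_min_sub_min_le_max (1 : ℝ) ((r + η - F x) / η) 1 ((r + η - F y) / η)
  have h3 : |(r + η - F x) / η - (r + η - F y) / η| = |F x - F y| / η := by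
    rw [← sub_div, abs_div, abs_of_pos hη,
      show r + η - F x - (r + η - F y) = -(F x - F y) by ring, abs_neg]
  rw [sub_self, abs_zero] at h1 h2
  exact (h1.trans (max_le (abs_nonneg _) le_rfl)).trans
    ((h2.trans (max_le (abs_nonneg _) le_rfl)).trans h3.le)

theorem abs_radialBump_sub_le_one {X : Type*} (F : X → ℝ) (r η : ℝ) (x y : X) :
    |radialBump F r η x - radialBump F r η y| ≤ 1 := by
  rw [abs_le]
  constructor <;> linarith [radialBump_nonneg F r η x, radialBump_nonneg F r η y,
    radialBump_le_one F r η x, radialBump_le_one F r η y]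

theorem measurable_radialBump {X : Type*} [MeasurableSpace X] {F : X → ℝ} (hF : Measurable F)
    (r η : ℝ) : Measurable (radialBump F r η) := by
  unfold radialBump
  fun_prop

theorem enorm_radialBump_le {X : Type*} {F : X → ℝ} {r η : ℝ} (hη : 0 < η) (x : X) :
    ‖radialBump F r η x‖ₑ ≤ ‖{x | F x < r + η}.indicator (fun _ => (1 : ℝ)) x‖ₑ := by
  by_cases h : F x < r + η
  · rw [Set.indicator_of_mem (by exact h), Real.enorm_of_nonneg (radialBump_nonneg _ _ _ _),
      Real.enorm_of_nonneg zero_le_one]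
    exact ENNReal.ofReal_le_ofReal (radialBump_le_one _ _ _ _)
  · simp [radialBump_eq_zero hη h]

theorem eLpNorm_radialBump_le {X : Type*} [MeasurableSpace X] (μ : Measure X) (F : X → ℝ) (r : ℝ)
    {η : ℝ} (hη : 0 < η) (p : ℝ≥0∞) :
    eLpNorm (radialBump F r η) p μ ≤ μ {x | F x < r + η} ^ (1 / p.toReal) := by
  refine (eLpNorm_mono_enorm (enorm_radialBump_le hη)).trans ?_
  simpa using eLpNorm_indicator_const_le (μ := μ) (1 : ℝ) (s := {x | F x < r + η}) p

theorem le_eLpNorm_radialBump {X : Type*} [MeasurableSpace X] (μ : Measure X) {F : X → ℝ}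
    (hF : Measurable F) (r : ℝ) {η : ℝ} (hη : 0 < η) {p : ℝ≥0∞} (hp : p ≠ 0) (hp' : p ≠ ∞) :
    μ {x | F x < r} ^ (1 / p.toReal) ≤ eLpNorm (radialBump F r η) p μ := by
  have h1 := eLpNorm_indicator_const (μ := μ) (c := (1 : ℝ))
    (measurableSet_lt hF (measurable_const (a := r))) hp hp'
  rw [enorm_one, one_mul] at h1
  rw [← h1]
  refine eLpNorm_mono_enorm fun x => ?_
  by_cases h : F x < r
  · rw [Set.indicator_of_mem (by exact h), radialBump_eq_one hη h]
  · rw [Set.indicator_of_notMem (by exact h)]; simp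

theorem measure_sublevel_lt_top {X : Type*} [MeasurableSpace X] {d : X → X → ℝ} {μ : Measure X}
    (hX : IsQuasiMetricMeasureSpace d μ) {F : X → ℝ} {κ β : ℝ} (hβ : 0 < β) (hκ : 0 < κ) {x₀ : X}
    (hF : ∀ x, d x₀ x ^ β ≤ κ * F x) (t : ℝ) : μ {x | F x < t} < ∞ := by
  -- The maximum with 1 keeps the radius positive when `t ≤ 0`.
  have h0 : 0 < max (κ * t) 1 := lt_max_of_lt_right one_pos
  refine (measure_mono fun x hx => ?_).trans_lt
    (hX.ball_lt_top x₀ (max (κ * t) 1 ^ β⁻¹) (Real.rpow_pos_of_pos h0 _))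
  have hx' : F x < t := hx
  have h1 : d x₀ x ^ β < max (κ * t) 1 :=
    ((hF x).trans_lt ((mul_lt_mul_iff_right₀ hκ).2 hx')).trans_le (le_max_left _ _)
  have h2 := Real.rpow_lt_rpow (Real.rpow_nonneg (hX.quasiMetric.nonneg _ _) _) h1
    (inv_pos.2 hβ)
  rwa [Real.rpow_rpow_inv (hX.quasiMetric.nonneg _ _) hβ.ne'] at h2

/-- The bump is 1 on `{F < r}` and vanishes off `{F < r + η}`, so the embedding inequality compares
the volumes of these two sets with different powers. The only input about the semi-norm is a bound
of order `1 / η` on bumps, so one argument serves all three spaces. -/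
theorem measure_univ_lt_top_of_embedsContinuously {X : Type*} [MeasurableSpace X]
    {d : X → X → ℝ} {μ : Measure X} (hX : IsQuasiMetricMeasureSpace d μ) {F : X → ℝ} {κ β : ℝ}
    (hβ : 0 < β) (hκ : 0 < κ) {x₀ : X} (hF : ∀ x y, |F x - F y| ≤ κ * d x y ^ β)
    (hFd : ∀ x, d x₀ x ^ β ≤ κ * F x) {p p' : ℝ≥0∞} (hp' : 0 < p') (hpp : p' < p) (hp : p < ∞)
    {s : (X → ℝ) → ℝ≥0∞} {K : ℝ} (hK : 0 ≤ K)
    (hs : ∀ r η, 0 < η → η ≤ 1 → s (radialBump F r η) ≤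
      ENNReal.ofReal (K / η) * μ {x | F x < r + η} ^ (1 / p.toReal))
    (hemb : EmbedsContinuously μ p s p') : μ Set.univ < ∞ := by
  by_contra hinf
  have htop : μ Set.univ = ∞ := not_lt_top_iff.1 hinf
  have hFm := measurable_of_holder hX hβ hκ hF
  have hfin := measure_sublevel_lt_top hX hβ hκ hFd
  obtain ⟨-, C, hC, hCe⟩ := hemb
  have hP' : 0 < p'.toReal := ENNReal.toReal_pos hp'.ne' (hpp.trans hp).ne
  have hPP : p'.toReal < p.toReal := ENNReal.toReal_strict_mono hp.ne hpp
  have hP : 0 < p.toReal := hP'.trans hPP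
  -- The summand 1 makes `D` positive even if `C = 0`; the `L^p` norm of the bump is absorbed
  -- through `1 ≤ 1 / η`.
  set D : ℝ := C.toReal * (1 + K) + 1 with hD
  have hD0 : 0 < D := by positivity
  refine false_of_superlinear_growth (V := fun r => (μ {x | F x < r}).toReal)
    (s := p.toReal / p'.toReal) (p := p.toReal) (C := D)
    (fun a b hab => ENNReal.toReal_mono (hfin b).ne
      (measure_mono fun x hx => lt_of_lt_of_le (show F x < a from hx) hab))
    ((one_lt_div hP').2 hPP) hP hD0 (fun r η hη hη1 => ?_) (fun M => ?_)
  · have hBp : μ {x | F x < r + η} ^ (1 / p.toReal) < ∞ :=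
      ENNReal.rpow_lt_top_of_nonneg (by positivity) (hfin _).ne
    have hmem : radialBump F r η ∈ inhomSpace μ p s :=
      ⟨measurable_radialBump hFm r η,
        ⟨(measurable_radialBump hFm r η).aestronglyMeasurable,
          (eLpNorm_radialBump_le μ F r hη p).trans_lt hBp⟩,
        (hs r η hη hη1).trans_lt (ENNReal.mul_lt_top ENNReal.ofReal_lt_top hBp)⟩
    have h1 : μ {x | F x < r} ^ (1 / p'.toReal) ≤
        ENNReal.ofReal (D / η) * μ {x | F x < r + η} ^ (1 / p.toReal) := by
      calc μ {x | F x < r} ^ (1 / p'.toReal) ≤ eLpNorm (radialBump F r η) p' μ :=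
            le_eLpNorm_radialBump μ hFm r hη hp'.ne' (hpp.trans hp).ne
        _ ≤ C * inhomNorm μ p s (radialBump F r η) := hCe _ hmem
        _ ≤ C * (μ {x | F x < r + η} ^ (1 / p.toReal) +
              ENNReal.ofReal (K / η) * μ {x | F x < r + η} ^ (1 / p.toReal)) := by
            gcongr
            exact add_le_add (eLpNorm_radialBump_le μ F r hη p) (hs r η hη hη1)
        _ = ENNReal.ofReal (C.toReal * (1 + K / η)) * μ {x | F x < r + η} ^ (1 / p.toReal) := by
            rw [ENNReal.ofReal_mul ENNReal.toReal_nonneg, ENNReal.ofReal_toReal hC.ne,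
              ENNReal.ofReal_add zero_le_one (by positivity), ENNReal.ofReal_one]
            ring
        _ ≤ ENNReal.ofReal (D / η) * μ {x | F x < r + η} ^ (1 / p.toReal) := by
            gcongr
            have h3 : (1 : ℝ) ≤ 1 / η := (one_le_div hη).2 hη1
            have h4 : 0 ≤ C.toReal := ENNReal.toReal_nonneg
            calc C.toReal * (1 + K / η) ≤ C.toReal * (1 / η + K / η) := by gcongr
              _ = C.toReal * (1 + K) / η := by ring
              _ ≤ D / η := by gcongr; linarith
    have h2 := ENNReal.toReal_mono
      (ENNReal.rpow_ne_top_of_nonneg hP.le (ENNReal.mul_ne_top ENNReal.ofReal_ne_top hBp.ne))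
      (ENNReal.rpow_le_rpow h1 hP.le)
    rw [ENNReal.mul_rpow_of_nonneg _ _ hP.le, ← ENNReal.rpow_mul, ← ENNReal.rpow_mul,
      one_div_mul_cancel hP.ne', ENNReal.rpow_one, ENNReal.toReal_mul, ← ENNReal.toReal_rpow,
      ← ENNReal.toReal_rpow, ENNReal.toReal_ofReal (by positivity), one_div_mul_eq_div] at h2
    exact h2
  · have hU : (⋃ n : ℕ, {x | F x < n}) = Set.univ :=
      Set.eq_univ_of_forall fun x => Set.mem_iUnion.2 (exists_nat_gt (F x))
    have hmono : Monotone fun n : ℕ => {x | F x < n} := fun a b hab x hx =>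
      lt_of_lt_of_le (show F x < a from hx) (Nat.cast_le.2 hab)
    have ht := tendsto_measure_iUnion_atTop (μ := μ) hmono
    rw [hU, htop] at ht
    obtain ⟨n, hn⟩ := (ht.eventually (lt_mem_nhds (ENNReal.ofReal_lt_top (r := M)))).exists
    exact ⟨n, (ENNReal.ofReal_le_iff_le_toReal (hfin _).ne).1 hn.le⟩

/-! ### Gradients of the cut-offs and the necessity of finite measure -/

theorem seqNorm_mul_const (q : ℝ≥0∞) (a : ℤ → ℝ≥0∞) (t : ℝ≥0∞) (hq : 0 < q) :
    seqNorm q (fun k => a k * t) = seqNorm q a * t := by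
  unfold seqNorm
  split_ifs with h
  · rw [ENNReal.iSup_mul]
  · have hq' : 0 < q.toReal := ENNReal.toReal_pos hq.ne' h
    simp_rw [ENNReal.mul_rpow_of_nonneg _ _ hq'.le]
    rw [ENNReal.tsum_mul_right, ENNReal.mul_rpow_of_nonneg _ _ (by positivity),
      ← ENNReal.rpow_mul, mul_one_div_cancel hq'.ne', ENNReal.rpow_one]

/-- For `q = ∞` the decay rate may be 0, which is why the endpoint is admitted only then. -/
theorem seqNorm_two_sided_geometric_lt_top {q : ℝ≥0∞} (hq : 0 < q) {γ : ℝ} (hγ : 0 ≤ γ)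
    (h : q = ∞ ∨ 0 < γ) :
    seqNorm q (fun k : ℤ => ENNReal.ofReal ((2 : ℝ) ^ (-γ * |(k : ℝ)|))) < ∞ := by
  unfold seqNorm
  split_ifs with hqt
  · refine (iSup_le fun k => ?_).trans_lt ENNReal.one_lt_top
    rw [ENNReal.ofReal_le_one]
    exact Real.rpow_le_one_of_one_le_of_nonpos (by norm_num)
      (mul_nonpos_of_nonpos_of_nonneg (by linarith) (abs_nonneg _))
  · have hγ' : 0 < γ := h.resolve_left hqt
    have hq' : 0 < q.toReal := ENNReal.toReal_pos hq.ne' hqt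
    refine ENNReal.rpow_lt_top_of_nonneg (by positivity) ?_
    have h2 : ∀ k : ℤ, ENNReal.ofReal ((2 : ℝ) ^ (-γ * |(k : ℝ)|)) ^ q.toReal =
        ENNReal.ofReal (((2 : ℝ) ^ (-γ * q.toReal)) ^ k.natAbs) := fun k => by
      rw [ENNReal.ofReal_rpow_of_nonneg (by positivity) hq'.le, ← Real.rpow_mul two_pos.le,
        ← Real.rpow_natCast, ← Real.rpow_mul two_pos.le, Nat.cast_natAbs, Int.cast_abs]
      congr 2; ring
    simp_rw [h2]
    have hr : (2 : ℝ) ^ (-γ * q.toReal) < 1 :=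
      Real.rpow_lt_one_of_one_lt_of_neg (by norm_num) (by nlinarith)
    have hsum := summable_geometric_of_lt_one (by positivity) hr
    have : Summable fun k : ℤ => ((2 : ℝ) ^ (-γ * q.toReal)) ^ k.natAbs :=
      Summable.of_nat_of_neg (by simpa using hsum) (by simpa using hsum)
    exact this.tsum_ofReal_ne_top

/-- At scales `k ≥ 0` the extra Hölder order gives `d ^ (α + γ) ≤ d ^ α * 2 ^ (-γ * k)`; at scales
`k < 0` the oscillation is at most 1 while `d ^ α ≥ 2 ^ (-α * k - α)`. The restriction to `{F < r +
η}` is harmless, since the bump vanishes at both points when both lie outside. -/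
theorem isFracGradient_radialBump {X : Type*} [MeasurableSpace X] {d : X → X → ℝ} {μ : Measure X}
    (hX : IsQuasiMetricMeasureSpace d μ) {F : X → ℝ} {κ α γ : ℝ} (hα : 0 < α) (hγ : 0 ≤ γ)
    (hκ : 0 < κ) (hF : ∀ x y, |F x - F y| ≤ κ * d x y ^ (α + γ)) (r : ℝ) {η : ℝ} (hη : 0 < η)
    (hη1 : η ≤ 1) :
    IsFracGradient d μ α (radialBump F r η) (fun k =>
      {x | F x < r + η}.indicator fun _ => ENNReal.ofReal ((2 : ℝ) ^ (-(min α γ) * |(k : ℝ)|)) *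
        ENNReal.ofReal (max κ (2 ^ α) / η)) := by
  have hFm := measurable_of_holder hX (by linarith : 0 < α + γ) hκ hF
  have hm : MeasurableSet {x | F x < r + η} := measurableSet_lt hFm measurable_const
  refine ⟨fun k => measurable_const.indicator hm, ∅, MeasurableSet.empty, measure_empty,
    fun k x y _ _ hk1 hk2 => ?_⟩
  have hd0 : 0 < d x y := lt_of_lt_of_le (by positivity) hk1
  have key : |radialBump F r η x - radialBump F r η y| ≤
      d x y ^ α * ((2 : ℝ) ^ (-(min α γ) * |(k : ℝ)|) * (max κ (2 ^ α) / η)) := by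
    rcases le_or_gt 0 k with hk | hk
    · have hk' : (0 : ℝ) ≤ k := by exact_mod_cast hk
      have h1 : d x y ^ γ ≤ (2 : ℝ) ^ (-(min α γ) * |(k : ℝ)|) := by
        calc d x y ^ γ ≤ ((2 : ℝ) ^ (-k)) ^ γ := Real.rpow_le_rpow hd0.le hk2.le hγ
          _ = (2 : ℝ) ^ (-γ * k) := by
            rw [← Real.rpow_intCast, ← Real.rpow_mul two_pos.le]
            congr 1; push_cast; ring
          _ ≤ _ := by
            refine Real.rpow_le_rpow_of_exponent_le (by norm_num) ?_
            rw [abs_of_nonneg hk']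
            have := min_le_right α γ
            nlinarith
      calc |radialBump F r η x - radialBump F r η y| ≤ |F x - F y| / η :=
            abs_radialBump_sub_le F r hη x y
        _ ≤ κ * d x y ^ (α + γ) / η := by gcongr; exact hF x y
        _ = d x y ^ α * (d x y ^ γ * (κ / η)) := by rw [Real.rpow_add hd0]; ring
        _ ≤ _ := by gcongr; exact le_max_left _ _
    · have hk' : (k : ℝ) ≤ 0 := by exact_mod_cast hk.le
      refine (abs_radialBump_sub_le_one F r η x y).trans ?_
      have h1 : (2 : ℝ) ^ (-α * k - α) ≤ d x y ^ α := by
        calc (2 : ℝ) ^ (-α * k - α) = ((2 : ℝ) ^ (-k - 1)) ^ α := by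
              rw [← Real.rpow_intCast, ← Real.rpow_mul two_pos.le]
              congr 1; push_cast; ring
          _ ≤ _ := Real.rpow_le_rpow (by positivity) hk1 hα.le
      have h2 : (2 : ℝ) ^ (α * k) ≤ (2 : ℝ) ^ (-(min α γ) * |(k : ℝ)|) := by
        refine Real.rpow_le_rpow_of_exponent_le (by norm_num) ?_
        rw [abs_of_nonpos hk']
        have := min_le_left α γ
        nlinarith
      have h3 : (2 : ℝ) ^ α ≤ max κ (2 ^ α) / η := by
        rw [le_div_iff₀ hη]
        have := le_max_right κ (2 ^ α)
        have h0 : (0 : ℝ) < 2 ^ α := by positivity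
        nlinarith
      calc (1 : ℝ) = (2 : ℝ) ^ (-α * k - α) * ((2 : ℝ) ^ (α * k) * (2 : ℝ) ^ α) := by
            rw [← Real.rpow_add two_pos, ← Real.rpow_add two_pos]
            ring_nf; simp
        _ ≤ _ := by gcongr
  have hkey : ENNReal.ofReal |radialBump F r η x - radialBump F r η y| ≤
      ENNReal.ofReal (d x y ^ α) * (ENNReal.ofReal ((2 : ℝ) ^ (-(min α γ) * |(k : ℝ)|)) *
        ENNReal.ofReal (max κ (2 ^ α) / η)) := by
    rw [← ENNReal.ofReal_mul (by positivity), ← ENNReal.ofReal_mul (by positivity)]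
    exact ENNReal.ofReal_le_ofReal key
  by_cases hx : F x < r + η
  · refine hkey.trans ?_
    gcongr
    beta_reduce
    rw [Set.indicator_of_mem (by exact hx)]
    exact le_self_add
  by_cases hy : F y < r + η
  · refine hkey.trans ?_
    gcongr
    beta_reduce
    rw [Set.indicator_of_mem (s := {x | F x < r + η}) (a := y) (by exact hy)]
    exact le_add_self
  · simp [radialBump_eq_zero hη hx, radialBump_eq_zero hη hy]

theorem isGradient_radialBump {X : Type*} [MeasurableSpace X] {d : X → X → ℝ} {μ : Measure X}
    (hX : IsQuasiMetricMeasureSpace d μ) {F : X → ℝ} {κ α : ℝ} (hα : 0 < α)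
    (hκ : 0 < κ) (hF : ∀ x y, |F x - F y| ≤ κ * d x y ^ α) (r : ℝ) {η : ℝ} (hη : 0 < η) :
    IsGradient d μ α (radialBump F r η)
      ({x | F x < r + η}.indicator fun _ => ENNReal.ofReal (κ / η)) := by
  have hFm := measurable_of_holder hX hα hκ hF
  have hm : MeasurableSet {x | F x < r + η} := measurableSet_lt hFm measurable_const
  refine ⟨measurable_const.indicator hm, ∅, MeasurableSet.empty, measure_empty,
    fun x y _ _ => ?_⟩
  have hkey : ENNReal.ofReal |radialBump F r η x - radialBump F r η y| ≤
      ENNReal.ofReal (d x y ^ α) * ENNReal.ofReal (κ / η) := by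
    rw [← ENNReal.ofReal_mul (Real.rpow_nonneg (hX.quasiMetric.nonneg _ _) _)]
    refine ENNReal.ofReal_le_ofReal ((abs_radialBump_sub_le F r hη x y).trans ?_)
    calc |F x - F y| / η ≤ κ * d x y ^ α / η := by gcongr; exact hF x y
      _ = _ := by ring
  by_cases hx : F x < r + η
  · refine hkey.trans ?_
    gcongr
    rw [Set.indicator_of_mem (by exact hx)]
    exact le_self_add
  by_cases hy : F y < r + η
  · refine hkey.trans ?_
    gcongr
    rw [Set.indicator_of_mem (s := {x | F x < r + η}) (a := y) (by exact hy)]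
    exact le_add_self
  · simp [radialBump_eq_zero hη hx, radialBump_eq_zero hη hy]

theorem measure_univ_lt_top_of_sobolev_embedding {X : Type*} [MeasurableSpace X]
    {d : X → X → ℝ} {μ : Measure X} (hX : IsQuasiMetricMeasureSpace d μ) {α : ℝ} {p p' : ℝ≥0∞}
    (hα : 0 < α) (hp' : 0 < p') (hpp : p' < p) (hp : p < ∞) (hind : PrecIndex d α)
    (hemb : EmbedsContinuously μ p (sobolevSeminorm d μ α p) p') : μ Set.univ < ∞ := by
  have := hX.nontrivial
  obtain ⟨ρ, hρ, he, hc⟩ := hind.exists_quasiConst_rpow_le_two hα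
  obtain ⟨x₀, -⟩ := exists_pair_ne X
  obtain ⟨F, κ, hκ, hF, hFd⟩ := exists_radial_function hX.quasiMetric hρ he hα hc x₀
  refine measure_univ_lt_top_of_embedsContinuously hX hα hκ hF hFd hp' hpp hp hκ.le
    (fun r η hη hη1 => ?_) hemb
  refine (iInf₂_le _ (isGradient_radialBump hX hα hκ hF r hη)).trans ?_
  exact eLpNorm_indicator_const_le _ _

/-- The fractional gradient of a bump is a sequence in `k` times an indicator in `x`, so its
Triebel–Lizorkin and Besov norms both factor into an `ℓ^q` norm times a power of the volume. -/
theorem measure_univ_lt_top_of_tl_or_besov_embedding {X : Type*} [MeasurableSpace X]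
    {d : X → X → ℝ} {μ : Measure X} (hX : IsQuasiMetricMeasureSpace d μ) {α : ℝ}
    {p p' q : ℝ≥0∞} (hα : 0 < α) (hp' : 0 < p') (hpp : p' < p) (hp : p < ∞) (hq : 0 < q)
    (hind : PrecIndexQ d q α)
    (hemb : EmbedsContinuously μ p (tlSeminorm d μ α p q) p' ∨
      EmbedsContinuously μ p (besovSeminorm d μ α p q) p') : μ Set.univ < ∞ := by
  have := hX.nontrivial
  obtain ⟨γ, hγ, hqγ, ρ, hρ, he, hc⟩ := hind.exists_quasiConst_rpow_le_two hα
  obtain ⟨x₀, -⟩ := exists_pair_ne X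
  have hαγ : 0 < α + γ := by linarith
  obtain ⟨F, κ, hκ, hF, hFd⟩ := exists_radial_function hX.quasiMetric hρ he hαγ hc x₀
  have hA := seqNorm_two_sided_geometric_lt_top (γ := min α γ) hq (le_min hα.le hγ)
    (hqγ.imp_right fun h => lt_min hα h)
  set a : ℤ → ℝ≥0∞ := fun k => ENNReal.ofReal ((2 : ℝ) ^ (-(min α γ) * |(k : ℝ)|)) with ha
  set A := (seqNorm q a).toReal
  have hm : (0 : ℝ) < max κ (2 ^ α) := lt_max_of_lt_left hκ
  have hAη : ∀ η : ℝ, 0 < η → seqNorm q a * ENNReal.ofReal (max κ (2 ^ α) / η) =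
      ENNReal.ofReal (A * max κ (2 ^ α) / η) := fun η hη => by
    rw [mul_div_assoc, ENNReal.ofReal_mul ENNReal.toReal_nonneg, ENNReal.ofReal_toReal hA.ne]
  have hK : 0 ≤ A * max κ (2 ^ α) := mul_nonneg ENNReal.toReal_nonneg hm.le
  have hp0 : p ≠ 0 := (hp'.trans hpp).ne'
  have hms : ∀ t, MeasurableSet {x | F x < t} := fun t =>
    measurableSet_lt (measurable_of_holder hX hαγ hκ hF) measurable_const
  rcases hemb with hemb | hemb
  · refine measure_univ_lt_top_of_embedsContinuously hX hαγ hκ hF hFd hp' hpp hp hK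
      (fun r η hη hη1 => ?_) hemb
    refine (iInf₂_le _ (isFracGradient_radialBump hX hα hγ hκ hF r hη hη1)).trans ?_
    rw [← hAη η hη]
    have hle := eLpNorm_indicator_const_le (μ := μ)
      (seqNorm q a * ENNReal.ofReal (max κ (2 ^ α) / η)) (s := {x | F x < r + η}) p
    rw [enorm_eq_self] at hle
    refine le_trans (le_of_eq ?_) hle
    congr 1
    funext x
    have := seqNorm_mul_const q a (({x | F x < r + η}.indicator
      fun _ => ENNReal.ofReal (max κ (2 ^ α) / η)) x) hq
    by_cases hx : F x < r + η
    · simp only [Set.indicator_of_mem (s := {x | F x < r + η}) (a := x) hx] at this ⊢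
      exact this
    · simp only [Set.indicator_of_notMem (s := {x | F x < r + η}) (a := x) hx, mul_zero] at this ⊢
      exact this
  · refine measure_univ_lt_top_of_embedsContinuously hX hαγ hκ hF hFd hp' hpp hp hK
      (fun r η hη hη1 => ?_) hemb
    refine (iInf₂_le _ (isFracGradient_radialBump hX hα hγ hκ hF r hη hη1)).trans ?_
    rw [← hAη η hη, mul_assoc, ← seqNorm_mul_const q a _ hq]
    refine le_of_eq ?_
    congr 1
    funext k
    rw [eLpNorm_indicator_const (hms _) hp0 hp.ne, enorm_eq_self, mul_assoc]

/-! ### Compactness in measure -/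

/-- A disjoint family of measurable sets of positive measure is countable when `μ` is finite.
Enlarging a disjoint family of equal balls that meets every ball of that radius yields the cover. -/
theorem IsQuasiMetricMeasureSpace.exists_countable_cover {X : Type*} [MeasurableSpace X]
    {d : X → X → ℝ} {μ : Measure X} (hX : IsQuasiMetricMeasureSpace d μ)
    (hfin : μ Set.univ < ∞) {r : ℝ} (hr : 0 < r) :
    ∃ B : ℕ → Set X, (∀ j, MeasurableSet (B j)) ∧ (⋃ j, B j) = Set.univ ∧
      ∀ j, ∀ x ∈ B j, ∀ y ∈ B j, d x y < r := by
  have : IsFiniteMeasure μ := ⟨hfin⟩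
  have := hX.nontrivial
  have hd := hX.quasiMetric
  obtain ⟨C₀, hC₀, h₀⟩ := hd.quasi_symm
  obtain ⟨C₁, hC₁, h₁⟩ := hd.quasi_triangle
  set m := max C₀ 1 with hm
  have hm0 : 0 < m := lt_max_of_lt_right one_pos
  have hstep : ∀ b x z t, 0 < t → d b z ≤ t → d x z ≤ t → d b x ≤ C₁ * m * t := by
    intro b x z t ht h1 h2
    calc d b x ≤ C₁ * max (d b z) (d z x) := h₁ b x z
      _ ≤ C₁ * (m * t) := by
        refine mul_le_mul_of_nonneg_left (max_le ?_ ?_) hC₁.le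
        · nlinarith [le_max_right C₀ 1]
        · nlinarith [le_max_left C₀ 1, h₀ x z]
      _ = C₁ * m * t := by ring
  have hstep' : ∀ b x y t, 0 < t → d b x ≤ t → d b y ≤ t → d x y ≤ C₁ * m * t := by
    intro b x y t ht h1 h2
    calc d x y ≤ C₁ * max (d x b) (d b y) := h₁ x y b
      _ ≤ C₁ * (m * t) := by
        refine mul_le_mul_of_nonneg_left (max_le ?_ ?_) hC₁.le
        · nlinarith [le_max_left C₀ 1, h₀ b x]
        · nlinarith [le_max_right C₀ 1]
      _ = C₁ * m * t := by ring
  set c := C₁ * m with hc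
  have hc0 : 0 < c := by positivity
  -- Each use of the quasi-triangle inequality costs a factor `c`; two of them and the doubled
  -- radius give diameters at most `r / 2`.
  set s := r / (4 * c ^ 2) with hs
  have hs0 : 0 < s := by positivity
  -- With the constant size function the covering lemma only provides a disjoint subfamily that
  -- meets every ball.
  obtain ⟨U, -, hUd, hU⟩ := Vitali.exists_disjoint_subfamily_covering_enlargement
    (fun x => quasiBall d x s) Set.univ (fun _ => (1 : ℝ)) 2 (by norm_num) (by simp) 1 (by simp)
    (fun x _ => ⟨x, by simpa [quasiBall, hd.self] using hs0⟩)
  have hcount : Countable U := by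
    have h := Measure.countable_meas_pos_of_disjoint_iUnion (μ := μ)
      (As := fun x : U => quasiBall d x s) (fun x => hX.measurableSet_ball x s hs0)
      (fun x y hxy => hUd x.2 y.2 (fun h => hxy (Subtype.ext h)))
    rw [← Set.countable_univ_iff]
    exact h.mono fun x _ => hX.ball_pos x s hs0
  have hne : Nonempty U := by
    obtain ⟨x, -⟩ := exists_pair_ne X
    obtain ⟨b, hb, -⟩ := hU x trivial
    exact ⟨⟨b, hb⟩⟩
  obtain ⟨e, he⟩ := exists_surjective_nat U
  refine ⟨fun j => quasiBall d (e j) (2 * c * s),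
    fun j => hX.measurableSet_ball _ _ (by positivity), ?_, fun j x hx y hy => ?_⟩
  · refine Set.eq_univ_of_forall fun x => Set.mem_iUnion.2 ?_
    obtain ⟨b, hb, ⟨z, hz1, hz2⟩, -⟩ := hU x trivial
    obtain ⟨j, hj⟩ := he ⟨b, hb⟩
    refine ⟨j, ?_⟩
    rw [hj]
    have h1 := hstep b x z s hs0 (le_of_lt hz2) (le_of_lt hz1)
    show d b x < 2 * c * s
    have : 0 < c * s := by positivity
    linarith
  · have h1 := hstep' (e j) x y (2 * c * s) (by positivity) (le_of_lt hx) (le_of_lt hy)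
    have h2 : c * (2 * c * s) = r / 2 := by
      rw [hs]; field_simp; ring
    linarith

/-- Approximation, outside a set of small measure, by functions that take boundedly many values
on the pieces of a countable cover. -/
theorem exists_piecewise_approximation {X : Type*} [MeasurableSpace X]
    {d : X → X → ℝ} {μ : Measure X} (hX : IsQuasiMetricMeasureSpace d μ)
    (hfin : μ Set.univ < ∞) {β : ℝ} (hβ : 0 < β) {u : ℕ → X → ℝ} {g : ℕ → X → ℝ≥0∞}
    (hu : ∀ n, Measurable (u n)) (hg : ∀ n, IsGradient d μ β (u n) (g n)) {P : ℝ} (hP : 0 < P)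
    {K : ℝ≥0∞} (hK : K < ∞) (huK : ∀ n, ∫⁻ x, ‖u n x‖ₑ ^ P ∂μ ≤ K)
    (hgK : ∀ n, ∫⁻ x, g n x ^ P ∂μ ≤ K) {ε : ℝ} (hε : 0 < ε) :
    ∃ (T : ℝ) (B : ℕ → Set X) (a : ℕ → ℕ → ℝ), (∀ j, MeasurableSet (B j)) ∧
      (⋃ j, B j) = Set.univ ∧ (∀ n j, |a n j| ≤ T) ∧
      ∀ n, ∃ S : Set X, μ S ≤ ENNReal.ofReal ε ∧
        ∀ x, x ∉ S → ∀ j, x ∈ B j → |u n x - a n j| ≤ ε := by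
  classical
  -- Chebyshev at height `T`, applied to `u n` and to `g n`, bounds the two bad sets by `ε` in
  -- total.
  obtain ⟨T, hT0, hT⟩ : ∃ T : ℝ, 0 < T ∧ 2 * K ≤ ENNReal.ofReal ε * ENNReal.ofReal T ^ P := by
    refine ⟨((2 * K).toReal / ε + 1) ^ P⁻¹, by positivity, ?_⟩
    rw [ENNReal.ofReal_rpow_of_pos (by positivity), Real.rpow_inv_rpow (by positivity) hP.ne',
      ← ENNReal.ofReal_mul hε.le, mul_add, mul_div_cancel₀ _ hε.ne',
      ENNReal.le_ofReal_iff_toReal_le (ENNReal.mul_lt_top (by simp) hK).ne (by positivity)]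
    linarith
  have hTP : ENNReal.ofReal T ^ P ≠ 0 := (ENNReal.rpow_pos (by simpa using hT0) (by simp)).ne'
  have hTP' : ENNReal.ofReal T ^ P ≠ ∞ := ENNReal.rpow_ne_top_of_nonneg hP.le (by simp)
  have cheb : ∀ f : X → ℝ≥0∞, Measurable f → ∫⁻ x, f x ^ P ∂μ ≤ K →
      ENNReal.ofReal T ^ P * μ {x | ENNReal.ofReal T ≤ f x} ≤ K := fun f hf hfK => by
    refine le_trans ?_
      ((mul_meas_ge_le_lintegral (hf.pow_const P) (ENNReal.ofReal T ^ P)).trans hfK)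
    exact mul_le_mul_right (measure_mono fun x hx => ENNReal.rpow_le_rpow hx hP.le) _
  -- At this distance, gradients below `T` allow an oscillation of at most `ε / (2 * T) * (T + T) =
  -- ε`.
  have hr : 0 < (ε / (2 * T)) ^ β⁻¹ := by positivity
  obtain ⟨B, hBm, hBU, hBd⟩ := hX.exists_countable_cover hfin hr
  choose hgm E hEm hE0 hE using hg
  let S : ℕ → Set X := fun n =>
    E n ∪ ({x | ENNReal.ofReal T ≤ ‖u n x‖ₑ} ∪ {x | ENNReal.ofReal T ≤ g n x})
  -- The value at some good point of the piece; 0 on a piece without good points, where nothing has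
  -- to be approximated.
  let a : ℕ → ℕ → ℝ := fun n j =>
    if h : ∃ y, y ∈ B j ∧ y ∉ S n then u n h.choose else 0
  have hS : ∀ n y, y ∉ S n → y ∉ E n ∧ |u n y| < T ∧ g n y < ENNReal.ofReal T := by
    intro n y hy
    simp only [S, Set.mem_union, Set.mem_ofPred_eq, not_or, not_le] at hy
    obtain ⟨h1, h2, h3⟩ := hy
    rw [← ofReal_norm, ENNReal.ofReal_lt_ofReal_iff hT0, Real.norm_eq_abs] at h2
    exact ⟨h1, h2, h3⟩
  refine ⟨T, B, a, hBm, hBU, fun n j => ?_, fun n => ⟨S n, ?_, fun x hx j hxj => ?_⟩⟩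
  · by_cases h : ∃ y, y ∈ B j ∧ y ∉ S n
    · simp only [a, dif_pos h]
      exact (hS n _ h.choose_spec.2).2.1.le
    · simp only [a, dif_neg h, abs_zero]
      exact hT0.le
  · have h1 : μ (S n) ≤
        μ {x | ENNReal.ofReal T ≤ ‖u n x‖ₑ} + μ {x | ENNReal.ofReal T ≤ g n x} := by
      refine (measure_union_le _ _).trans ?_
      rw [hE0 n, zero_add]
      exact measure_union_le _ _
    have h2 := add_le_add (cheb _ (hu n).enorm (huK n)) (cheb _ (hgm n) (hgK n))
    rw [← mul_add, ← two_mul] at h2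
    refine h1.trans ?_
    rw [← ENNReal.mul_le_mul_iff_right hTP hTP']
    exact (h2.trans hT).trans (mul_comm _ _).le
  · have h : ∃ y, y ∈ B j ∧ y ∉ S n := ⟨x, hxj, hx⟩
    have ha : a n j = u n h.choose := dif_pos h
    obtain ⟨hyj, hy⟩ := h.choose_spec
    rw [ha]
    generalize h.choose = y at hyj hy
    obtain ⟨hx1, -, hx3⟩ := hS n x hx
    obtain ⟨hy1, -, hy3⟩ := hS n y hy
    have hdn := hX.quasiMetric.nonneg x y
    have hdb : d x y ^ β ≤ ε / (2 * T) := by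
      have := Real.rpow_le_rpow hdn (hBd j x hxj y hyj).le hβ.le
      rwa [Real.rpow_inv_rpow (by positivity) hβ.ne'] at this
    rw [← ENNReal.ofReal_le_ofReal_iff hε.le]
    calc ENNReal.ofReal |u n x - u n y| ≤ ENNReal.ofReal (d x y ^ β) * (g n x + g n y) :=
          hE n x y hx1 hy1
      _ ≤ ENNReal.ofReal (ε / (2 * T)) * (ENNReal.ofReal T + ENNReal.ofReal T) := by
          gcongr
      _ = ENNReal.ofReal ε := by
          rw [← ENNReal.ofReal_add hT0.le hT0.le, ← ENNReal.ofReal_mul (by positivity)]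
          congr 1; field_simp; ring

theorem exists_subseq_forall_tendsto {ι : Type*} [Countable ι] {a : ℕ → ι → ℝ} {M : ι → ℝ}
    (ha : ∀ n i, |a n i| ≤ M i) :
    ∃ φ : ℕ → ℕ, StrictMono φ ∧ ∀ i, ∃ l, Tendsto (fun n => a (φ n) i) atTop (𝓝 l) := by
  obtain ⟨l, -, φ, hφ, hl⟩ := (isCompact_univ_pi fun i => isCompact_Icc
    (a := -M i) (b := M i)).tendsto_subseq (x := a) fun n i _ => abs_le.1 (ha n i)
  exact ⟨φ, hφ, fun i => ⟨l i, (tendsto_pi_nhds.1 hl) i⟩⟩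

/-- By continuity from above, finitely many pieces cover all but measure `ε / 3`, and on finitely
many pieces the values are uniformly Cauchy. The two bad sets `S n`, `S k` account for the rest. -/
theorem cauchy_in_measure_of_piecewise_approximation {X : Type*} [MeasurableSpace X]
    {μ : Measure X} [IsFiniteMeasure μ] {w : ℕ → X → ℝ}
    (h : ∀ ε : ℝ, 0 < ε → ∃ (B : ℕ → Set X) (a : ℕ → ℕ → ℝ), (∀ j, MeasurableSet (B j)) ∧
      (⋃ j, B j) = Set.univ ∧ (∀ j, CauchySeq fun n => a n j) ∧
      ∀ n, ∃ S : Set X, μ S ≤ ENNReal.ofReal ε ∧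
        ∀ x, x ∉ S → ∀ j, x ∈ B j → |w n x - a n j| ≤ ε) {ε : ℝ} (hε : 0 < ε) :
    ∃ N, ∀ n ≥ N, ∀ k ≥ N, μ {x | ε < |w n x - w k x|} ≤ ENNReal.ofReal ε := by
  have hε3 : 0 < ε / 3 := by linarith
  obtain ⟨B, a, hBm, hBU, ha, hS⟩ := h (ε / 3) hε3
  choose S hSμ hSa using hS
  let A : ℕ → Set X := fun J => (⋃ j ∈ Finset.range J, B j)ᶜ
  have hAm : ∀ J, MeasurableSet (A J) := fun J =>
    (Finset.measurableSet_biUnion _ fun j _ => hBm j).compl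
  have hAanti : Antitone A := fun I J hIJ => Set.compl_subset_compl.2
    (Set.biUnion_subset_biUnion_left fun j hj => by
      simp only [Finset.coe_range, Set.mem_Iio] at hj ⊢
      exact hj.trans_le hIJ)
  have hAi : ⋂ J, A J = ∅ := by
    refine Set.eq_empty_of_forall_notMem fun x hx => ?_
    obtain ⟨j, hj⟩ := Set.mem_iUnion.1 (hBU.symm ▸ Set.mem_univ x : x ∈ ⋃ j, B j)
    exact (Set.mem_iInter.1 hx (j + 1)) (Set.mem_biUnion (by simp) hj)
  have hAt := tendsto_measure_iInter_atTop (μ := μ) (fun J => (hAm J).nullMeasurableSet) hAanti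
    ⟨0, measure_ne_top _ _⟩
  rw [hAi, measure_empty] at hAt
  obtain ⟨J, hJ⟩ := (hAt.eventually (ge_mem_nhds (ENNReal.ofReal_pos.2 hε3))).exists
  choose N hN using fun j => Metric.cauchySeq_iff.1 (ha j) (ε / 3) hε3
  refine ⟨(Finset.range J).sup N, fun n hn k hk => ?_⟩
  have hsub : {x | ε < |w n x - w k x|} ⊆ S n ∪ (S k ∪ A J) := by
    intro x hx
    by_contra hx'
    simp only [Set.mem_union, not_or] at hx'
    obtain ⟨hxn, hxk, hxA⟩ := hx'
    obtain ⟨j, hj, hxj⟩ := Set.mem_iUnion₂.1 (Set.notMem_compl_iff.1 hxA)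
    have hNj : N j ≤ (Finset.range J).sup N := Finset.le_sup hj
    have h1 := hSa n x hxn j hxj
    have h2 := hSa k x hxk j hxj
    have h3 := hN j n (hNj.trans hn) k (hNj.trans hk)
    rw [Real.dist_eq] at h3
    have hx2 : ε < |w n x - w k x| := hx
    have h4 : |w n x - w k x| ≤ |w n x - a n j| + |a n j - a k j| + |w k x - a k j| := by
      rw [abs_sub_comm (w k x)]
      exact (abs_sub_le _ (a k j) _).trans (add_le_add_left (abs_sub_le _ _ _) _)
    linarith
  calc μ {x | ε < |w n x - w k x|} ≤ μ (S n) + (μ (S k) + μ (A J)) :=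
        (measure_mono hsub).trans ((measure_union_le _ _).trans
          (add_le_add_right (measure_union_le _ _) _))
    _ ≤ ENNReal.ofReal (ε / 3) + (ENNReal.ofReal (ε / 3) + ENNReal.ofReal (ε / 3)) :=
        add_le_add (hSμ n) (add_le_add (hSμ k) hJ)
    _ = ENNReal.ofReal ε := by
        rw [← ENNReal.ofReal_add hε3.le hε3.le, ← ENNReal.ofReal_add hε3.le (by linarith)]
        congr 1; ring

/-- Borel–Cantelli along a subsequence whose consecutive differences exceed `2 ^ (-m)` only on sets
of measure at most `2 ^ (-m)`. -/
theorem exists_subseq_ae_tendsto_of_cauchy_in_measure {X : Type*} [MeasurableSpace X]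
    {μ : Measure X} {w : ℕ → X → ℝ}
    (h : ∀ ε : ℝ, 0 < ε →
      ∃ N, ∀ n ≥ N, ∀ k ≥ N, μ {x | ε < |w n x - w k x|} ≤ ENNReal.ofReal ε) :
    ∃ φ : ℕ → ℕ, StrictMono φ ∧ ∀ᵐ x ∂μ, ∃ l, Tendsto (fun n => w (φ n) x) atTop (𝓝 l) := by
  obtain ⟨φ, hφ, hP⟩ := extraction_forall_of_eventually
    (P := fun m k => ∀ n ≥ k, μ {x | (1 / 2 : ℝ) ^ m < |w k x - w n x|} ≤
      ENNReal.ofReal ((1 / 2) ^ m)) (fun m => by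
      obtain ⟨N, hN⟩ := h ((1 / 2) ^ m) (by positivity)
      filter_upwards [eventually_ge_atTop N] with k hk n hn using hN k hk n (hk.trans hn))
  refine ⟨φ, hφ, ?_⟩
  have hsum : Summable fun m : ℕ => (1 / 2 : ℝ) ^ m := summable_geometric_two
  have hfin : ∑' m, μ {x | (1 / 2 : ℝ) ^ m < |w (φ m) x - w (φ (m + 1)) x|} ≠ ∞ :=
    ne_top_of_le_ne_top hsum.tsum_ofReal_ne_top
      (ENNReal.tsum_le_tsum fun m => hP m _ (hφ.monotone m.le_succ))
  filter_upwards [ae_eventually_notMem hfin] with x hx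
  refine cauchySeq_tendsto_of_complete (cauchySeq_of_summable_dist ?_)
  refine Summable.of_norm_bounded_eventually_nat hsum ?_
  filter_upwards [hx] with m hm
  rw [Real.norm_of_nonneg dist_nonneg, Real.dist_eq]
  exact not_lt.1 hm

/-- The approximants for all accuracies `1 / (m + 1)` and all pieces `j` form one sequence in a
countable product of intervals, so a single extraction makes all of them converge. -/
theorem exists_subseq_ae_tendsto_of_gradient_bound {X : Type*} [MeasurableSpace X]
    {d : X → X → ℝ} {μ : Measure X} (hX : IsQuasiMetricMeasureSpace d μ)
    (hfin : μ Set.univ < ∞) {β : ℝ} (hβ : 0 < β) {u : ℕ → X → ℝ} {g : ℕ → X → ℝ≥0∞}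
    (hu : ∀ n, Measurable (u n)) (hg : ∀ n, IsGradient d μ β (u n) (g n)) {P : ℝ} (hP : 0 < P)
    {K : ℝ≥0∞} (hK : K < ∞) (huK : ∀ n, ∫⁻ x, ‖u n x‖ₑ ^ P ∂μ ≤ K)
    (hgK : ∀ n, ∫⁻ x, g n x ^ P ∂μ ≤ K) :
    ∃ (φ : ℕ → ℕ) (v : X → ℝ), StrictMono φ ∧ Measurable v ∧
      ∀ᵐ x ∂μ, Tendsto (fun n => u (φ n) x) atTop (𝓝 (v x)) := by
  have : IsFiniteMeasure μ := ⟨hfin⟩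
  have hpos : ∀ m : ℕ, (0 : ℝ) < 1 / (m + 1) := fun m => Nat.one_div_pos_of_nat
  choose T B a hBm hBU haT hS using fun m : ℕ =>
    exists_piecewise_approximation hX hfin hβ hu hg hP hK huK hgK (hpos m)
  obtain ⟨φ, hφ, hl⟩ := exists_subseq_forall_tendsto (a := fun n (i : ℕ × ℕ) => a i.1 n i.2)
    (M := fun i => T i.1) (fun n i => haT i.1 n i.2)
  obtain ⟨ψ, hψ, hae⟩ := exists_subseq_ae_tendsto_of_cauchy_in_measure (μ := μ)
    (w := fun n => u (φ n)) (fun ε hε => cauchy_in_measure_of_piecewise_approximation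
      (fun ε hε => by
        obtain ⟨m, hm⟩ := exists_nat_one_div_lt hε
        refine ⟨B m, fun n j => a m (φ n) j, hBm m, hBU m, fun j => ?_, fun n => ?_⟩
        · obtain ⟨l, hl⟩ := hl (m, j)
          exact hl.cauchySeq
        · obtain ⟨S, h1, h2⟩ := hS m (φ n)
          exact ⟨S, h1.trans (ENNReal.ofReal_le_ofReal hm.le),
            fun x hx j hj => (h2 x hx j hj).trans hm.le⟩) hε)
  obtain ⟨v, hv, hvl⟩ := measurable_limit_of_tendsto_metrizable_ae
    (fun n => (hu (φ (ψ n))).aemeasurable) hae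
  exact ⟨φ ∘ ψ, v, hφ.comp hψ, hv, hvl⟩

/-! ### From almost everywhere convergence to compact embeddings -/

theorem rpow_le_min_rpow_add {P P' : ℝ} (hP' : 0 < P') (h : P' < P) {M : ℝ≥0∞} (hM : M ≠ 0)
    (hM' : M ≠ ∞) (t : ℝ≥0∞) : t ^ P' ≤ min t M ^ P' + t ^ P * (M ^ (P - P'))⁻¹ := by
  rcases le_total t M with ht | ht
  · rw [min_eq_left ht]; exact le_self_add
  · refine le_trans ?_ le_add_self
    rw [← div_eq_mul_inv, ENNReal.le_div_iff_mul_le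
      (Or.inl (ENNReal.rpow_pos (pos_iff_ne_zero.2 hM) hM').ne')
      (Or.inl (ENNReal.rpow_ne_top_of_nonneg (by linarith) hM'))]
    calc t ^ P' * M ^ (P - P') ≤ t ^ P' * t ^ (P - P') := by
          gcongr
      _ = t ^ P := by
          rw [← ENNReal.rpow_add_of_nonneg _ _ hP'.le (by linarith), add_sub_cancel]

/-- Truncation at height `M`: the tail is at most `R ^ p * M ^ (p' - p)` uniformly in `n`, and the
truncated part tends to 0 by dominated convergence on a finite measure space. -/
theorem tendsto_eLpNorm_zero_of_ae_of_bounded {X : Type*} [MeasurableSpace X]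
    {μ : Measure X} [IsFiniteMeasure μ] {w : ℕ → X → ℝ} (hw : ∀ n, Measurable (w n))
    (hlim : ∀ᵐ x ∂μ, Tendsto (fun n => w n x) atTop (𝓝 0)) {p p' : ℝ≥0∞} (hp' : 0 < p')
    (hpp : p' < p) (hp : p < ∞) {R : ℝ≥0∞} (hR : R < ∞) (hwR : ∀ n, eLpNorm (w n) p μ ≤ R) :
    Tendsto (fun n => eLpNorm (w n) p' μ) atTop (𝓝 0) := by
  have hp't : p' ≠ ∞ := (hpp.trans hp).ne
  have hP' : 0 < p'.toReal := ENNReal.toReal_pos hp'.ne' hp't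
  have hPP : p'.toReal < p.toReal := ENNReal.toReal_strict_mono hp.ne hpp
  have hP : 0 < p.toReal := hP'.trans hPP
  have hwK : ∀ n, ∫⁻ x, ‖w n x‖ₑ ^ p.toReal ∂μ ≤ R ^ p.toReal := fun n => by
    have := hwR n
    rwa [eLpNorm_eq_lintegral_rpow_enorm_toReal (hp'.trans hpp).ne' hp.ne, one_div,
      ENNReal.rpow_inv_le_iff hP] at this
  have hK : R ^ p.toReal ≠ ∞ := ENNReal.rpow_ne_top_of_nonneg hP.le hR.ne
  suffices hI : Tendsto (fun n => ∫⁻ x, ‖w n x‖ₑ ^ p'.toReal ∂μ) atTop (𝓝 0) by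
    have := hI.ennrpow_const (1 / p'.toReal)
    rw [ENNReal.zero_rpow_of_pos (by positivity)] at this
    simpa only [eLpNorm_eq_lintegral_rpow_enorm_toReal hp'.ne' hp't] using this
  rw [ENNReal.tendsto_nhds_zero]
  intro ε hε
  have hε2 : 0 < ε / 2 := ENNReal.half_pos hε.ne'
  have htail : Tendsto (fun M : ℕ => R ^ p.toReal * ((M : ℝ≥0∞) ^ (p.toReal - p'.toReal))⁻¹)
      atTop (𝓝 0) := by
    have h1 := (ENNReal.tendsto_nat_nhds_top.ennrpow_const (p.toReal - p'.toReal)).inv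
    rw [ENNReal.top_rpow_of_pos (by linarith), ENNReal.inv_top] at h1
    simpa using ENNReal.Tendsto.const_mul h1 (Or.inr hK)
  obtain ⟨M, hM, hM0⟩ := ((htail.eventually (ge_mem_nhds hε2)).and (eventually_gt_atTop 0)).exists
  have hMne : (M : ℝ≥0∞) ≠ 0 := by exact_mod_cast hM0.ne'
  have hMt : (M : ℝ≥0∞) ≠ ∞ := ENNReal.natCast_ne_top M
  have hdct := tendsto_lintegral_of_dominated_convergence (μ := μ)
    (F := fun n x => min ‖w n x‖ₑ M ^ p'.toReal) (f := fun _ => 0)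
    (fun _ => (M : ℝ≥0∞) ^ p'.toReal)
    (fun n => ((hw n).enorm.min measurable_const).pow_const _)
    (fun n => Eventually.of_forall fun x =>
      ENNReal.rpow_le_rpow (min_le_right _ _) hP'.le)
    (by
      rw [lintegral_const]
      exact ENNReal.mul_ne_top (ENNReal.rpow_ne_top_of_nonneg hP'.le hMt) (measure_ne_top _ _))
    (by
      filter_upwards [hlim] with x hx
      have h1 := ((hx.enorm.min (tendsto_const_nhds (x := (M : ℝ≥0∞)))).ennrpow_const p'.toReal)
      simpa [ENNReal.zero_rpow_of_pos hP'] using h1)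
  rw [lintegral_zero] at hdct
  filter_upwards [hdct.eventually (ge_mem_nhds hε2)] with n hn
  calc ∫⁻ x, ‖w n x‖ₑ ^ p'.toReal ∂μ ≤ ∫⁻ x, (min ‖w n x‖ₑ M ^ p'.toReal +
        ‖w n x‖ₑ ^ p.toReal * ((M : ℝ≥0∞) ^ (p.toReal - p'.toReal))⁻¹) ∂μ :=
        lintegral_mono fun x => rpow_le_min_rpow_add hP' hPP hMne hMt _
    _ = ∫⁻ x, min ‖w n x‖ₑ M ^ p'.toReal ∂μ +
        (∫⁻ x, ‖w n x‖ₑ ^ p.toReal ∂μ) * ((M : ℝ≥0∞) ^ (p.toReal - p'.toReal))⁻¹ := by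
        rw [lintegral_add_left (((hw n).enorm.min measurable_const).pow_const _),
          lintegral_mul_const _ ((hw n).enorm.pow_const _)]
    _ ≤ ε / 2 + ε / 2 := by
        refine add_le_add hn (le_trans ?_ hM)
        gcongr
        exact hwK n
    _ = ε := ENNReal.add_halves ε

/-- If bounded sets of the space have uniformly `p`-integrable gradients, then the space embeds
compactly. -/
theorem embedsCompactly_of_gradient_bound {X : Type*} [MeasurableSpace X]
    {d : X → X → ℝ} {μ : Measure X} (hX : IsQuasiMetricMeasureSpace d μ)
    (hfin : μ Set.univ < ∞) {β : ℝ} (hβ : 0 < β) {p p' : ℝ≥0∞} (hp' : 0 < p') (hpp : p' < p)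
    (hp : p < ∞) {s : (X → ℝ) → ℝ≥0∞}
    (hs : ∀ R : ℝ≥0∞, R < ∞ → ∃ K : ℝ≥0∞, K < ∞ ∧ ∀ u ∈ inhomSpace μ p s,
      inhomNorm μ p s u ≤ R → ∃ g, IsGradient d μ β u g ∧ ∫⁻ x, g x ^ p.toReal ∂μ ≤ K) :
    EmbedsCompactly μ p s p' := by
  have : IsFiniteMeasure μ := ⟨hfin⟩
  have hp't : p' ≠ ∞ := (hpp.trans hp).ne
  have hP : 0 < p.toReal := ENNReal.toReal_pos (hp'.trans hpp).ne' hp.ne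
  have hPP : p'.toReal < p.toReal := ENNReal.toReal_strict_mono hp.ne hpp
  have hP' : 0 < p'.toReal := ENNReal.toReal_pos hp'.ne' hp't
  refine ⟨⟨fun u hu => hu.2.1.mono_exponent hpp.le,
    μ Set.univ ^ (1 / p'.toReal - 1 / p.toReal), ?_, fun u hu => ?_⟩, fun u hu hb => ?_⟩
  · refine ENNReal.rpow_lt_top_of_nonneg ?_ hfin.ne
    rw [sub_nonneg]
    exact one_div_le_one_div_of_le hP' hPP.le
  · refine (eLpNorm_le_eLpNorm_mul_rpow_measure_univ hpp.le hu.2.1.1).trans ?_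
    rw [mul_comm]
    gcongr
    exact le_self_add
  · obtain ⟨R, hR, hRu⟩ := hb
    obtain ⟨K, hK, hKg⟩ := hs R hR
    choose g hg hgK using fun n => hKg (u n) (hu n) (hRu n)
    have huR : ∀ n, eLpNorm (u n) p μ ≤ R := fun n => le_self_add.trans (hRu n)
    have huK : ∀ n, ∫⁻ x, ‖u n x‖ₑ ^ p.toReal ∂μ ≤ R ^ p.toReal := fun n => by
      have := huR n
      rwa [eLpNorm_eq_lintegral_rpow_enorm_toReal (hp'.trans hpp).ne' hp.ne, one_div,
        ENNReal.rpow_inv_le_iff hP] at this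
    obtain ⟨φ, v, hφ, hv, hlim⟩ := exists_subseq_ae_tendsto_of_gradient_bound hX hfin hβ
      (fun n => (hu n).1) hg hP (K := max K (R ^ p.toReal))
      (max_lt hK (ENNReal.rpow_lt_top_of_nonneg hP.le hR.ne))
      (fun n => (huK n).trans (le_max_right _ _)) (fun n => (hgK n).trans (le_max_left _ _))
    -- Fatou's lemma puts the limit into `L^p`.
    have hvR : eLpNorm v p μ ≤ R := by
      refine (Lp.eLpNorm_lim_le_liminf_eLpNorm (f := fun n => u (φ n))
        (fun n => (hu (φ n)).2.1.1) v hlim).trans ?_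
      exact (liminf_le_liminf (Eventually.of_forall fun n => huR (φ n))).trans
        (liminf_const R).le
    have hvp : MemLp v p μ := ⟨hv.aestronglyMeasurable, hvR.trans_lt hR⟩
    refine ⟨φ, v, hφ, hvp.mono_exponent hpp.le, ?_⟩
    -- `LpAddConst` enters because the triangle inequality fails for `p < 1`.
    refine tendsto_eLpNorm_zero_of_ae_of_bounded (w := fun n => u (φ n) - v)
      (fun n => (hu (φ n)).1.sub hv) ?_ hp' hpp hp (R := ENNReal.LpAddConst p * (R + R)) ?_ fun n => ?_
    · filter_upwards [hlim] with x hx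
      simpa using hx.sub_const (v x)
    · exact ENNReal.mul_lt_top (ENNReal.LpAddConst_lt_top p) (ENNReal.add_lt_top.2 ⟨hR, hR⟩)
    · refine (eLpNorm_sub_le' (hu (φ n)).2.1.1 hvp.1 p).trans ?_
      gcongr
      exact huR _

/-! ### Gradients for the three spaces -/

theorem lintegral_rpow_le_of_eLpNorm_le {X : Type*} [MeasurableSpace X] {μ : Measure X}
    {p : ℝ≥0∞} (hp0 : 0 < p) (hp : p < ∞) {f : X → ℝ≥0∞} {R : ℝ≥0∞} (h : eLpNorm f p μ ≤ R) :
    ∫⁻ x, f x ^ p.toReal ∂μ ≤ R ^ p.toReal := by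
  rwa [eLpNorm_eq_lintegral_rpow_enorm_toReal hp0.ne' hp.ne, one_div,
    ENNReal.rpow_inv_le_iff (ENNReal.toReal_pos hp0.ne' hp.ne)] at h

theorem embedsCompactly_sobolev {X : Type*} [MeasurableSpace X]
    {d : X → X → ℝ} {μ : Measure X} (hX : IsQuasiMetricMeasureSpace d μ)
    (hfin : μ Set.univ < ∞) {α : ℝ} (hα : 0 < α) {p p' : ℝ≥0∞} (hp' : 0 < p') (hpp : p' < p)
    (hp : p < ∞) : EmbedsCompactly μ p (sobolevSeminorm d μ α p) p' := by
  refine embedsCompactly_of_gradient_bound hX hfin hα hp' hpp hp fun R hR =>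
    ⟨(R + 1) ^ p.toReal, ENNReal.rpow_lt_top_of_nonneg ENNReal.toReal_nonneg (by simp [hR.ne]),
      fun u hu hRu => ?_⟩
  -- The infimum need not be attained; the slack 1 supplies an actual gradient.
  have h1 : sobolevSeminorm d μ α p u < R + 1 :=
    (le_add_self.trans hRu).trans_lt (ENNReal.lt_add_right hR.ne one_ne_zero)
  obtain ⟨g, h2⟩ := iInf_lt_iff.1 h1
  obtain ⟨hg, h3⟩ := iInf_lt_iff.1 h2
  exact ⟨g, hg, lintegral_rpow_le_of_eLpNorm_le (hp'.trans hpp) hp h3.le⟩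

theorem le_seqNorm {q : ℝ≥0∞} (hq : 0 < q) (a : ℤ → ℝ≥0∞) (k : ℤ) : a k ≤ seqNorm q a := by
  unfold seqNorm
  split_ifs with h
  · exact le_iSup a k
  · rw [one_div, ENNReal.le_rpow_inv_iff (ENNReal.toReal_pos hq.ne' h)]
    exact ENNReal.le_tsum k

theorem exists_dyadic_scale {t : ℝ} (ht : 0 < t) :
    ∃ k : ℤ, (2 : ℝ) ^ (-k - 1) ≤ t ∧ t < (2 : ℝ) ^ (-k) := by
  obtain ⟨n, h1, h2⟩ := exists_mem_Ico_zpow ht (one_lt_two (α := ℝ))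
  exact ⟨-n - 1, by simpa using h1, by simpa [add_comm] using h2⟩

/-- Every positive distance lies in a dyadic shell. This settles the Triebel–Lizorkin case without
loss of order, as the supremum is at most the `ℓ^q` norm pointwise. -/
theorem IsFracGradient.isGradient_iSup {X : Type*} [MeasurableSpace X] {d : X → X → ℝ}
    {μ : Measure X} (hd : IsQuasiMetric d) {α : ℝ} {u : X → ℝ} {g : ℤ → X → ℝ≥0∞}
    (hg : IsFracGradient d μ α u g) : IsGradient d μ α u (fun x => ⨆ k, g k x) := by
  obtain ⟨hm, E, hE, hE0, h⟩ := hg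
  refine ⟨Measurable.iSup hm, E, hE, hE0, fun x y hx hy => ?_⟩
  rcases (hd.nonneg x y).eq_or_lt with h0 | h0
  · rw [(hd.eq_zero_iff x y).1 h0.symm]; simp
  · obtain ⟨k, h1, h2⟩ := exists_dyadic_scale h0
    refine (h k x y hx hy h1 h2).trans ?_
    gcongr
    · exact le_iSup (fun k => g k x) k
    · exact le_iSup (fun k => g k y) k

theorem embedsCompactly_tl {X : Type*} [MeasurableSpace X]
    {d : X → X → ℝ} {μ : Measure X} (hX : IsQuasiMetricMeasureSpace d μ)
    (hfin : μ Set.univ < ∞) {α : ℝ} (hα : 0 < α) {p p' q : ℝ≥0∞} (hp' : 0 < p') (hpp : p' < p)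
    (hp : p < ∞) (hq : 0 < q) : EmbedsCompactly μ p (tlSeminorm d μ α p q) p' := by
  refine embedsCompactly_of_gradient_bound hX hfin hα hp' hpp hp fun R hR =>
    ⟨(R + 1) ^ p.toReal, ENNReal.rpow_lt_top_of_nonneg ENNReal.toReal_nonneg (by simp [hR.ne]),
      fun u hu hRu => ?_⟩
  have h1 : tlSeminorm d μ α p q u < R + 1 :=
    (le_add_self.trans hRu).trans_lt (ENNReal.lt_add_right hR.ne one_ne_zero)
  obtain ⟨g, h2⟩ := iInf_lt_iff.1 h1
  obtain ⟨hg, h3⟩ := iInf_lt_iff.1 h2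
  refine ⟨_, hg.isGradient_iSup hX.quasiMetric,
    lintegral_rpow_le_of_eLpNorm_le (hp'.trans hpp) hp (le_trans ?_ h3.le)⟩
  refine eLpNorm_mono_enorm fun x => ?_
  simp only [enorm_eq_self]
  exact iSup_le fun k => le_seqNorm hq (fun k => g k x) k

/-- A gradient of order `β` obtained from a fractional gradient of order `2β` by summing over the
scales below `1`. -/
theorem IsFracGradient.isGradient_sum {X : Type*} [MeasurableSpace X] {d : X → X → ℝ}
    {μ : Measure X} (hd : IsQuasiMetric d) {β P : ℝ} (hβ : 0 < β) (hP : 0 < P) {u : X → ℝ}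
    (hu : Measurable u) {g : ℤ → X → ℝ≥0∞} (hg : IsFracGradient d μ (2 * β) u g) :
    IsGradient d μ β u (fun x => (‖u x‖ₑ ^ P +
      ∑' k : ℕ, (ENNReal.ofReal (((2 : ℝ) ^ (-β)) ^ k) * g k x) ^ P) ^ (1 / P)) := by
  obtain ⟨hm, E, hE, hE0, h⟩ := hg
  refine ⟨((hu.enorm.pow_const P).add (Measurable.tsum fun k : ℕ =>
    ((hm k).const_mul _).pow_const P)).pow_const _, E, hE, hE0, fun x y hx hy => ?_⟩
  have hle1 : ∀ z, ‖u z‖ₑ ≤ (‖u z‖ₑ ^ P +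
      ∑' k : ℕ, (ENNReal.ofReal (((2 : ℝ) ^ (-β)) ^ k) * g k z) ^ P) ^ (1 / P) := fun z => by
    rw [one_div, ENNReal.le_rpow_inv_iff hP]
    exact le_self_add
  have hle2 : ∀ z (k : ℕ), ENNReal.ofReal (((2 : ℝ) ^ (-β)) ^ k) * g k z ≤ (‖u z‖ₑ ^ P +
      ∑' k : ℕ, (ENNReal.ofReal (((2 : ℝ) ^ (-β)) ^ k) * g k z) ^ P) ^ (1 / P) := fun z k => by
    rw [one_div, ENNReal.le_rpow_inv_iff hP]
    exact le_add_left (ENNReal.le_tsum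
      (f := fun k : ℕ => (ENNReal.ofReal (((2 : ℝ) ^ (-β)) ^ k) * g k z) ^ P) k)
  rcases (hd.nonneg x y).eq_or_lt with h0 | h0
  · rw [(hd.eq_zero_iff x y).1 h0.symm]; simp
  obtain ⟨k, h1, h2⟩ := exists_dyadic_scale h0
  rcases le_or_gt 0 k with hk | hk
  · lift k to ℕ using hk
    -- Half of the order is spent on the factor `2 ^ (-β * k)`, which makes the sum over scales
    -- converge.
    have hdβ : d x y ^ (2 * β) ≤ d x y ^ β * ((2 : ℝ) ^ (-β)) ^ k := by
      rw [two_mul, Real.rpow_add h0]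
      gcongr
      calc d x y ^ β ≤ ((2 : ℝ) ^ (-(k : ℤ))) ^ β := Real.rpow_le_rpow h0.le h2.le hβ.le
        _ = ((2 : ℝ) ^ (-β)) ^ k := by
          rw [← Real.rpow_intCast, ← Real.rpow_mul two_pos.le, ← Real.rpow_natCast,
            ← Real.rpow_mul two_pos.le]
          congr 1; push_cast; ring
    calc ENNReal.ofReal |u x - u y| ≤ ENNReal.ofReal (d x y ^ (2 * β)) * (g k x + g k y) :=
          h k x y hx hy h1 h2
      _ ≤ ENNReal.ofReal (d x y ^ β * ((2 : ℝ) ^ (-β)) ^ k) * (g k x + g k y) := by gcongr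
      _ = ENNReal.ofReal (d x y ^ β) * (ENNReal.ofReal (((2 : ℝ) ^ (-β)) ^ k) * g k x +
            ENNReal.ofReal (((2 : ℝ) ^ (-β)) ^ k) * g k y) := by
          rw [ENNReal.ofReal_mul (by positivity)]; ring
      _ ≤ _ := by
          gcongr
          · exact hle2 x k
          · exact hle2 y k
  -- Here `k < 0`, so the distance is at least 1 and `|u|` itself serves as a gradient.
  · have hd1 : 1 ≤ d x y ^ β := by
      refine Real.one_le_rpow (le_trans ?_ h1) hβ.le
      exact one_le_zpow₀ one_le_two (by omega)
    calc ENNReal.ofReal |u x - u y| = ‖u x - u y‖ₑ := by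
          rw [← ofReal_norm, Real.norm_eq_abs]
      _ ≤ ‖u x‖ₑ + ‖u y‖ₑ := enorm_sub_le
      _ ≤ ENNReal.ofReal (d x y ^ β) * (‖u x‖ₑ + ‖u y‖ₑ) :=
          le_mul_of_one_le_left zero_le (ENNReal.one_le_ofReal.2 hd1)
      _ ≤ _ := by
          gcongr
          · exact hle1 x
          · exact hle1 y

/-- A Besov bound controls each `g k` in `L^p` uniformly in `k`, but in general not their supremum.
Passing to order `β = α / 2` brings in geometric weights, and combining the scales in `ℓ^p` makes
the integral of the `p`-th power a geometric series. -/
theorem embedsCompactly_besov {X : Type*} [MeasurableSpace X]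
    {d : X → X → ℝ} {μ : Measure X} (hX : IsQuasiMetricMeasureSpace d μ)
    (hfin : μ Set.univ < ∞) {α : ℝ} (hα : 0 < α) {p p' q : ℝ≥0∞} (hp' : 0 < p') (hpp : p' < p)
    (hp : p < ∞) (hq : 0 < q) : EmbedsCompactly μ p (besovSeminorm d μ α p q) p' := by
  obtain ⟨β, rfl⟩ : ∃ β, α = 2 * β := ⟨α / 2, by ring⟩
  have hβ : 0 < β := by linarith
  have hp0 := hp'.trans hpp
  have hP : 0 < p.toReal := ENNReal.toReal_pos hp0.ne' hp.ne
  set r : ℝ≥0∞ := ENNReal.ofReal (2 ^ (-β)) ^ p.toReal with hr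
  have hr1 : r < 1 := ENNReal.rpow_lt_one (ENNReal.ofReal_lt_one.2
    (Real.rpow_lt_one_of_one_lt_of_neg one_lt_two (by linarith))) hP
  refine embedsCompactly_of_gradient_bound hX hfin hβ hp' hpp hp fun R hR =>
    ⟨R ^ p.toReal + (1 - r)⁻¹ * (R + 1) ^ p.toReal, ?_, fun u hu hRu => ?_⟩
  · have h1 : (R + 1) ^ p.toReal < ∞ := ENNReal.rpow_lt_top_of_nonneg hP.le (by simp [hR.ne])
    have h2 : R ^ p.toReal < ∞ := ENNReal.rpow_lt_top_of_nonneg hP.le hR.ne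
    have h3 : (1 - r)⁻¹ < ∞ := ENNReal.inv_lt_top.2 (tsub_pos_of_lt hr1)
    exact ENNReal.add_lt_top.2 ⟨h2, ENNReal.mul_lt_top h3 h1⟩
  have h1 : besovSeminorm d μ (2 * β) p q u < R + 1 :=
    (le_add_self.trans hRu).trans_lt (ENNReal.lt_add_right hR.ne one_ne_zero)
  obtain ⟨g, h2⟩ := iInf_lt_iff.1 h1
  obtain ⟨hg, h3⟩ := iInf_lt_iff.1 h2
  refine ⟨_, hg.isGradient_sum hX.quasiMetric hβ hP hu.1, ?_⟩
  have hgk : ∀ k, ∫⁻ x, g k x ^ p.toReal ∂μ ≤ (R + 1) ^ p.toReal := fun k =>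
    lintegral_rpow_le_of_eLpNorm_le hp0 hp
      ((le_seqNorm hq (fun k => eLpNorm (g k) p μ) k).trans h3.le)
  have huR : ∫⁻ x, ‖u x‖ₑ ^ p.toReal ∂μ ≤ R ^ p.toReal :=
    lintegral_rpow_le_of_eLpNorm_le hp0 hp (by
      rw [eLpNorm_enorm]; exact le_self_add.trans hRu)
  simp_rw [← ENNReal.rpow_mul, one_div_mul_cancel hP.ne', ENNReal.rpow_one]
  rw [lintegral_add_left (hu.1.enorm.pow_const _), lintegral_tsum fun k : ℕ =>
    (((hg.1 k).const_mul _).pow_const _).aemeasurable]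
  refine add_le_add huR ?_
  rw [← ENNReal.tsum_geometric, ← ENNReal.tsum_mul_right]
  refine ENNReal.tsum_le_tsum fun k => ?_
  simp_rw [ENNReal.mul_rpow_of_nonneg _ _ hP.le]
  rw [lintegral_const_mul _ ((hg.1 k).pow_const _)]
  refine mul_le_mul' (le_of_eq ?_) (hgk k)
  rw [hr, ENNReal.ofReal_pow (by positivity), ← ENNReal.rpow_natCast, ← ENNReal.rpow_natCast,
    ← ENNReal.rpow_mul, ← ENNReal.rpow_mul, mul_comm]

theorem mainTheorem5 {X : Type*} [MeasurableSpace X] (d : X → X → ℝ) (μ : Measure X)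
    (hX : IsQuasiMetricMeasureSpace d μ) :
    (μ Set.univ < ∞ →
      ∀ (α : ℝ) (p p' : ℝ≥0∞), 0 < α → 0 < p' → p' < p → p < ∞ →
        (∀ q : ℝ≥0∞, 0 < q →
          EmbedsCompactly μ p (tlSeminorm d μ α p q) p' ∧
          EmbedsCompactly μ p (besovSeminorm d μ α p q) p') ∧
        EmbedsCompactly μ p (sobolevSeminorm d μ α p) p') ∧
    (∀ (α : ℝ) (p p' q : ℝ≥0∞), 0 < α → 0 < p' → p' < p → p < ∞ → 0 < q →
      PrecIndexQ d q α →
      EmbedsContinuously μ p (tlSeminorm d μ α p q) p' ∨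
        EmbedsContinuously μ p (besovSeminorm d μ α p q) p' →
      μ Set.univ < ∞) ∧
    (∀ (α : ℝ) (p p' : ℝ≥0∞), 0 < α → 0 < p' → p' < p → p < ∞ →
      PrecIndex d α →
      EmbedsContinuously μ p (sobolevSeminorm d μ α p) p' →
      μ Set.univ < ∞) := by
  refine ⟨fun hfin α p p' hα hp' hpp hp => ⟨fun q hq => ⟨?_, ?_⟩, ?_⟩,
    fun α p p' q hα hp' hpp hp hq hind hemb => ?_, fun α p p' hα hp' hpp hp hind hemb => ?_⟩
  · exact embedsCompactly_tl hX hfin hα hp' hpp hp hq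
  · exact embedsCompactly_besov hX hfin hα hp' hpp hp hq
  · exact embedsCompactly_sobolev hX hfin hα hp' hpp hp
  · exact measure_univ_lt_top_of_tl_or_besov_embedding hX hα hp' hpp hp hq hind hemb
  · exact measure_univ_lt_top_of_sobolev_embedding hX hα hp' hpp hp hind hemb
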